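/- **Notation.** For $0\le s\le m$ and $a,b\in\mathbb C^m$ put $\langle a,b\rangle_s=-\sum_{j\le s}a_jb_j+\sum_{j>s}a_jb_j$, and let $\mathbb H^{2N+1}_{s}=\{(z',w')\in\mathbb C^N\times\mathbb C:\operatorname{Im}w'=\langle z',\bar z'\rangle_{s}\}$. Let $\mathrm{Aut}(\mathbb H^{2N+1}_{s},0)$ be the group of local biholomorphisms of $(\mathbb C^{N+1},0)$ preserving $\mathbb H^{2N+1}_{s}$. A formal real hypersurface $M\subset\mathbb C^{n+1}$ at $p$ is given by an equation $\rho(Z,\bar Z)=0$, where $\rho$ is a real-valued formal power series at $p$ with $\rho(p)=0$ and $d\rho(p)\neq0$; series that differ by a unit factor define the same hypersurface. $M$ is Levi-nondegenerate of signature $\ell$ $(\ell\le n/2)$ at $p$ if in suitable formal holomorphic coordinates $(z,w)\in\mathbb C^n\times\mathbb C$ vanishing at $p$ it is given by $\operatorname{Im}w=\langle z,\bar z\rangle_\ell+A(z,\bar z,w,\bar w)$ with $A$ a real-valued formal power series vanishing to at least third order at $0$. A formal embedding $H:(M,p)\to(M',0)$ is a formal holomorphic map of the ambient spaces with $H(p)=0$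 and with injective differential at $p$ that sends $M$ into $M'$; it is CR transversal if $dH(T_pM)\not\subset T^c_0M'=T_0M'\cap iT_0M'$. **Theorem 5.3.** Let $M$ be a formal Levi-nondegenerate hypersurface in $\mathbb C^{n+1}$ of signature $\ell$ at a point $p$. Let $k_1,k_2\ge0$ and $\ell_1,\ell_2$ be integers with $\ell\le\ell_q<n-\ell$ $(q=1,2)$, and suppose that there are two formal CR transversal embeddings $$H_q:(M,p)\to(\mathbb H^{2(n+k_q)+1}_{\ell_q},0),\qquad q=1,2 .$$ If $k_1+k_2<n$, then there exist automorphisms $T_q\in\mathrm{Aut}(\mathbb H^{2(n+k_q)+1}_{\ell_q},0)$, $q=1,2$, formal holomorphic coordinates $(z,w)\in\mathbb C^n\times\mathbb C$ vanishing at $p$ (the same for $q=1$ and $q=2$), and tuples $\phi_q=\phi_q(z,w)$ of $k_q$ formal power series without constant or linear terms, such that $$(T_q\circ H_q)(z,w)=(z,\phi_q(z,w),w)\in\mathbb C^n\times\mathbb C^{k_q}\times\mathbb C,\quad q=1,2,\qquad \langle\phi_1,\overline{\phi_1}\rangle_{\ell_1-\ell}\equiv\langle\phi_2,\overline{\phi_2}\rangle_{\ell_2-\ell}$$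 as formal power series in $(z,\bar z,w,\bar w)$. Here the coordinates $z'$ of $\mathbb C^{n+k_q}=\mathbb C^n\times\mathbb C^{k_q}$ are renumbered so that $\langle z',\bar z'\rangle_{\ell_q}$ becomes $$-\sum_{j=1}^{\ell}|z'_j|^2+\sum_{j=\ell+1}^{n}|z'_j|^2-\sum_{j=n+1}^{n+\ell_q-\ell}|z'_j|^2+\sum_{j=n+\ell_q-\ell+1}^{n+k_q}|z'_j|^2 ;$$ in particular, $\ell_q-\ell\le k_q$ (this is part of the conclusion). -/

import Mathlib

noncomputable section

namespace FormalCR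

open MvPowerSeries

/-- Index set of the coordinates `(z, w)` of `ℂⁿ × ℂ = ℂⁿ⁺¹`: `Sum.inl j` is the index of `z_j`
and `Sum.inr ()` is the index of `w`. -/
abbrev Coord (n : ℕ) : Type := Fin n ⊕ Unit

/-- Formal holomorphic power series in `Z = (z, w) ∈ ℂⁿ × ℂ`. -/
abbrev HolSeries (n : ℕ) : Type := MvPowerSeries (Coord n) ℂ

/-- Formal power series in `(Z, Z̄)`, `Z = (z, w) ∈ ℂⁿ × ℂ`. The variables `Sum.inl i` are the
`Z_i`, the variables `Sum.inr i` are the conjugates `Z̄_i`. -/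
abbrev MixedSeries (n : ℕ) : Type := MvPowerSeries (Coord n ⊕ Coord n) ℂ

/-- A holomorphic series `f(Z)`, viewed as a series in `(Z, Z̄)`. -/
def hol {n : ℕ} (f : HolSeries n) : MixedSeries n := rename Sum.inl f

/-- The series `conj (f(Z))` in `(Z, Z̄)`: coefficients are conjugated, `Z_i` becomes `Z̄_i`. -/
def antihol {n : ℕ} (f : HolSeries n) : MixedSeries n :=
  rename Sum.inr (map (starRingEnd ℂ) f)

/-- The complex conjugate of a series in `(Z, Z̄)`: coefficients are conjugated, and `Z_i`, `Z̄_i`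
are interchanged. -/
def conjSeries {n : ℕ} (A : MixedSeries n) : MixedSeries n :=
  rename Sum.swap (map (starRingEnd ℂ) A)

/-- `A` is real-valued: `A(Z, Z̄) = conj (A(Z, Z̄))`. -/
def IsRealValued {n : ℕ} (A : MixedSeries n) : Prop := conjSeries A = A

/-- The sign of the `j`-th square in the scalar product of signature `ℓ`: the first `ℓ`
squares are negative, the others are positive. -/
def sgn (ℓ : ℕ) {m : ℕ} (j : Fin m) : ℂ := if (j : ℕ) < ℓ then -1 else 1

/-- `⟨φ, φ̄⟩_s = -∑_{j ≤ s} |φ_j|² + ∑_{j > s} |φ_j|²` as a series in `(Z, Z̄)`. -/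
def hermSq {n k : ℕ} (s : ℕ) (φ : Fin k → HolSeries n) : MixedSeries n :=
  ∑ j, C (sgn s j) * (hol (φ j) * antihol (φ j))

/-- `Im w - ⟨z, z̄⟩_ℓ`. -/
def quadricSeries (n ℓ : ℕ) : MixedSeries n :=
  C (1 / (2 * Complex.I)) * (hol (X (Sum.inr ())) - antihol (X (Sum.inr ())))
    - hermSq ℓ (fun j => X (Sum.inl j))

/-- A formal real hypersurface in `ℂⁿ⁺¹` through the origin (the reference point), given by a
real-valued formal equation `ρ(Z, Z̄) = 0` with `ρ(0) = 0` and `dρ(0) ≠ 0`. -/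
structure FormalHypersurface (n : ℕ) where
  ρ : MixedSeries n
  real : IsRealValued ρ
  zero : constantCoeff ρ = 0
  nonsingular : ∃ i, coeff (Finsupp.single i 1) ρ ≠ 0

/-- A tuple of formal series, as a formal holomorphic map from `ℂᵐ⁺¹` to `ℂⁿ⁺¹`. -/
abbrev FormalMap (m n : ℕ) : Type := Coord n → HolSeries m

/-- `H(0) = 0`. -/
def FixesZero {m n : ℕ} (H : FormalMap m n) : Prop := ∀ i, constantCoeff (H i) = 0

/-- The composition `T ∘ H` (used for maps `H` with `H(0) = 0`). -/
def comp {m n p : ℕ} (T : FormalMap n p) (H : FormalMap m n) : FormalMap m p :=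
  fun i => subst H (T i)

/-- The complex Jacobian matrix of `H` at `0`. -/
def jac {m n : ℕ} (H : FormalMap m n) : Matrix (Coord n) (Coord m) ℂ :=
  Matrix.of fun i j => coeff (Finsupp.single j 1) (H i)

/-- A formal biholomorphism `(ℂⁿ⁺¹, 0) → (ℂⁿ⁺¹, 0)`; equivalently, a system of formal holomorphic
coordinates vanishing at `0`, given by the map from the new coordinates to the old ones. -/
structure IsFormalBiholomorphism {n : ℕ} (Φ : FormalMap n n) : Prop where
  fixesZero : FixesZero Φ
  jac_isUnit : IsUnit (jac Φ)

/-- The series `A(H(Z), conj (H(Z)))`. -/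
def pullback {m n : ℕ} (H : FormalMap m n) (A : MixedSeries n) : MixedSeries m :=
  subst (Sum.elim (fun i => hol (H i)) (fun i => antihol (H i))) A

/-- `H` sends `M` into `M'`: the pullback of the equation of `M'` vanishes on `M`. -/
def SendsInto {m n : ℕ} (H : FormalMap m n) (M : FormalHypersurface m)
    (M' : FormalHypersurface n) : Prop :=
  M.ρ ∣ pullback H M'.ρ

/-- `M` is Levi-nondegenerate of signature `ℓ ≤ n / 2` at the origin: in suitable formal holomorphic
coordinates `(z, w)` vanishing there, `M` is defined by `Im w = ⟨z, z̄⟩_ℓ + A(z, z̄, w, w̄)`, where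
`A` is real-valued and vanishes to third order. (Two series define the same hypersurface if they
differ by a unit factor.) -/
def IsLeviNondegenerate {n : ℕ} (M : FormalHypersurface n) (ℓ : ℕ) : Prop :=
  2 * ℓ ≤ n ∧ ∃ (Φ : FormalMap n n) (A : MixedSeries n),
    IsFormalBiholomorphism Φ ∧ IsRealValued A ∧ 3 ≤ A.order ∧
      Associated (pullback Φ M.ρ) (quadricSeries n ℓ - A)

/-- The real tangent space `T₀M = {v : dρ(0)(v) = 0}`, with
`dρ(0)(v) = ∑ ρ_{Z_i}(0) v_i + ∑ ρ_{Z̄_i}(0) v̄_i`. -/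
def tangent {n : ℕ} (M : FormalHypersurface n) : Set (Coord n → ℂ) :=
  {v | ∑ i, coeff (Finsupp.single (Sum.inl i) 1) M.ρ * v i
      + ∑ i, coeff (Finsupp.single (Sum.inr i) 1) M.ρ * (starRingEnd ℂ) (v i) = 0}

/-- The complex tangent space `T₀ᶜM = T₀M ∩ i T₀M`. -/
def complexTangent {n : ℕ} (M : FormalHypersurface n) : Set (Coord n → ℂ) :=
  tangent M ∩ (fun v => Complex.I • v) '' tangent M

/-- `H : (M, 0) → (M', 0)` is a formal CR transversal embedding: a formal holomorphic map with
injective differential, sending `M` into `M'`, with `dH(T₀M) ⊄ T₀ᶜM'`. -/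
structure IsCRTransversalEmbedding {m n : ℕ} (H : FormalMap m n) (M : FormalHypersurface m)
    (M' : FormalHypersurface n) : Prop where
  fixesZero : FixesZero H
  injective : Function.Injective (jac H).mulVec
  sendsInto : SendsInto H M M'
  transversal : ¬ (jac H).mulVec '' tangent M ⊆ complexTangent M'

/-- `f` converges absolutely on some polydisc around `0`. -/
def IsConvergent {n : ℕ} (f : HolSeries n) : Prop :=
  ∃ r : ℝ, 0 < r ∧ Summable fun d : Coord n →₀ ℕ => ‖coeff d f‖ * r ^ d.degree

/-- `T ∈ Aut(M, 0)`: (the Taylor series of) a local biholomorphism `(ℂⁿ⁺¹, 0) → (ℂⁿ⁺¹, 0)` that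
preserves `M`. -/
structure IsLocalAut {n : ℕ} (T : FormalMap n n) (M : FormalHypersurface n) : Prop where
  biholomorphism : IsFormalBiholomorphism T
  convergent : ∀ i, IsConvergent (T i)
  preserves : Associated (pullback T M.ρ) M.ρ

/-- `e` renumbers the coordinates `(z, ζ) ∈ ℂⁿ × ℂᵏ` as coordinates of `ℂⁿ⁺ᵏ` in such a way that
`⟨·, ·⟩_ℓ'` on `ℂⁿ⁺ᵏ` becomes the orthogonal sum of `⟨·, ·⟩_ℓ` on `ℂⁿ` and `⟨·, ·⟩_(ℓ' - ℓ)` on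
`ℂᵏ`. -/
def IsRenumbering {n k : ℕ} (ℓ ℓ' : ℕ) (e : Fin n ⊕ Fin k ≃ Fin (n + k)) : Prop :=
  (∀ j, sgn ℓ' (e (Sum.inl j)) = sgn ℓ j) ∧ (∀ j, sgn ℓ' (e (Sum.inr j)) = sgn (ℓ' - ℓ) j)

/-- The formal map `(z, w) ↦ (z, φ(z, w), w) ∈ ℂⁿ × ℂᵏ × ℂ`, where the coordinates of
`ℂⁿ × ℂᵏ` are numbered by `e`. -/
def graphMap {n k : ℕ} (e : Fin n ⊕ Fin k ≃ Fin (n + k)) (φ : Fin k → HolSeries n) :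
    FormalMap n (n + k) :=
  Sum.elim (fun a => Sum.elim (fun j => X (Sum.inl j)) φ (e.symm a)) (fun _ => X (Sum.inr ()))

theorem conj_hol {n : ℕ} (f : HolSeries n) : conjSeries (hol f) = antihol f := by
  unfold conjSeries hol antihol
  rw [← rename_map, rename_rename]
  rfl

theorem conj_antihol {n : ℕ} (f : HolSeries n) : conjSeries (antihol f) = hol f := by
  unfold conjSeries hol antihol
  rw [← rename_map, rename_rename]
  congr 1
  ext d
  simp

theorem isRealValued_quadricSeries (n ℓ : ℕ) : IsRealValued (quadricSeries n ℓ) := by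
  have h1 : ∀ f : HolSeries n, rename Sum.swap (map (starRingEnd ℂ) (hol f)) = antihol f :=
    conj_hol
  have h2 : ∀ f : HolSeries n, rename Sum.swap (map (starRingEnd ℂ) (antihol f)) = hol f :=
    conj_antihol
  have h3 : ∀ (m : ℕ) (j : Fin m), (starRingEnd ℂ) (sgn ℓ j) = sgn ℓ j := by
    intro m j
    unfold sgn
    split_ifs <;> simp
  have h4 : (starRingEnd ℂ) (1 / (2 * Complex.I)) = -(1 / (2 * Complex.I)) := by
    have : (starRingEnd ℂ) (2 : ℂ) = 2 := Complex.conj_ofNat 2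
    simp [this]
  unfold IsRealValued conjSeries quadricSeries hermSq
  simp only [map_sub, map_mul, map_sum, map_C, rename_C, h1, h2, h3, h4]
  simp only [map_neg, mul_comm (antihol _) (hol _)]
  ring

theorem coeff_w_quadricSeries (n ℓ : ℕ) :
    coeff (Finsupp.single (Sum.inl (Sum.inr ())) 1) (quadricSeries n ℓ) = 1 / (2 * Complex.I) := by
  classical
  simp only [quadricSeries, hermSq, hol, antihol, map_sub, map_sum, map_X, rename_X, coeff_C_mul,
    coeff_index_single_X, mul_comm (X (Sum.inl _)) (X (Sum.inr _))]
  rw [Finset.sum_eq_zero]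
  · simp
  · intro j _
    rw [X, X, monomial_mul_monomial, coeff_monomial, if_neg, mul_zero]
    intro h
    have := congrArg Finsupp.degree h
    simp [Finsupp.degree_single] at this

/-- The hyperquadric `ℍ_ℓ^{2n+1} = {Im w = ⟨z, z̄⟩_ℓ}` in `ℂⁿ⁺¹`. -/
def hyperquadric (n ℓ : ℕ) : FormalHypersurface n where
  ρ := quadricSeries n ℓ
  real := isRealValued_quadricSeries n ℓ
  zero := by
    simp [quadricSeries, hermSq, hol, antihol]
  nonsingular := ⟨Sum.inl (Sum.inr ()), by rw [coeff_w_quadricSeries]; simp⟩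

end FormalCR

end

open FormalCR

/-! ### Rank of a multiple of the scalar product -/

namespace FormalCR

open MvPowerSeries

/-! The first embedding supplies the coordinates, and a rigidity statement shows that they also suit
the second one. Comparing terms of low order in the mapping equation shows that the differential of
a transversal embedding respects the Levi forms up to a real factor `u ≠ 0`. The inequality `ℓ' + ℓ
< n` forces `u > 0`. By a Witt extension and an explicit isotropy transformation, a linear
fractional automorphism of the target then makes the linear part equal to `(z, 0, w)`
(`exists_normalization`). For the first embedding the formal inverse function theorem turns the `z`
and `w` components into the coordinates themselves. Hence `M` becomes `Im w = ⟨z, z̄⟩ + ⟨φ₁, φ̄₁⟩`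
(`exists_graph_coordinates`).

In these coordinates the second embedding is normalized to first order and written in homogeneous
coordinates `[h : f : φ₂ : g]`, so that `U · (Im w - ⟨z, z̄⟩ - ⟨φ₁, φ̄₁⟩) = Im (g h̄) - ⟨f, f̄⟩ -
⟨φ₂, φ̄₂⟩`. A common holomorphic factor is free, and it is used to remove all purely holomorphic
terms from `V = U - 1`. Give `z` weight one and `w` weight three. If `V` starts at weight `m`, the
terms linear in `Z̄` force the deviation of `(h, f, g)` from `(1, z, w)` to contribute nothing at
weight `m + 2`, and what remains there is `-⟨z, z̄⟩ V_m = ⟨φ₁, φ̄₁⟩ - ⟨φ₂, φ̄₂⟩`.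

As an array of coefficients indexed by exponents of `Z` and of `Z̄`, the right side has rank at most
`k₁ + k₂ < n`. A nonzero multiple of `⟨z, z̄⟩` has rank at least `n`
(`eq_zero_of_mul_scalarProduct_rank_lt`). So `V_m = 0`, and by induction `V = 0`
(`eq_of_mul_quadric_eq`). Therefore `f = z`, `g = w`, the two Hermitian squares agree, and `h = 1 +
r w` with `r` real. This last parameter is absorbed by one more automorphism
(`exists_graph_of_graph`). -/

/-- Exponents are compared through the lexicographic order on integer vectors. -/
noncomputable def lexExp (σ : Type*) [Fintype σ] : (σ →₀ ℕ) →+ Lex (Fin (Fintype.card σ) → ℤ) where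
  toFun α := toLex fun i => (α ((Fintype.equivFin σ).symm i) : ℤ)
  map_zero' := congrArg toLex (funext fun i => by simp)
  map_add' a b := congrArg toLex (funext fun i => by simp)

theorem lexExp_injective (σ : Type*) [Fintype σ] : Function.Injective (lexExp σ) := by
  intro a b h
  ext i
  have h1 : (a ((Fintype.equivFin σ).symm (Fintype.equivFin σ i)) : ℤ) =
      b ((Fintype.equivFin σ).symm (Fintype.equivFin σ i)) :=
    congrFun (congrArg ofLex h) (Fintype.equivFin σ i)
  simpa using h1

/-- Positive weights leave finitely many exponents in each weight, so extremal elements of a support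
of given weight exist. -/
theorem finite_weight_add_le {σ : Type*} [Finite σ] (w : σ → ℕ) (hw : ∀ i, 0 < w i) (m : ℕ) :
    {p : (σ →₀ ℕ) × (σ →₀ ℕ) | Finsupp.weight w p.1 + Finsupp.weight w p.2 = m}.Finite := by
  have h1 := Finsupp.finite_of_nat_weight_le w (fun i => (hw i).ne') m
  apply (h1.prod h1).subset
  rintro ⟨a, b⟩ h
  simp only [Set.mem_ofPred_eq, Set.mem_prod] at h ⊢
  omega

/-- A nonzero doubly indexed array of total weight `m`, multiplied by
`∑ s_k z_k χ_k`, has rank at least `n`. -/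
theorem eq_zero_of_mul_scalarProduct_rank_lt {σ : Type*} [Fintype σ] {n k : ℕ} (hk : k < n)
    (z : Fin n → σ) (hz : Function.Injective z) (w : σ → ℕ) (hw : ∀ i, 0 < w i)
    (hwz : ∀ j, w (z j) = 1) (s : Fin n → ℂ) (hs : ∀ j, s j ≠ 0)
    (v : (σ →₀ ℕ) → (σ →₀ ℕ) → ℂ) (m : ℕ) (a b : Fin k → (σ →₀ ℕ) → ℂ)
    (S : (σ →₀ ℕ) → (σ →₀ ℕ) → ℂ)
    (hS : ∀ α β, S α β = ∑ j, s j * (if Finsupp.single (z j) 1 ≤ α ∧ Finsupp.single (z j) 1 ≤ β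
      then v (α - Finsupp.single (z j) 1) (β - Finsupp.single (z j) 1) else 0))
    (hR : ∀ α β, Finsupp.weight w α + Finsupp.weight w β = m + 2 →
      S α β = ∑ i, a i α * b i β) :
    ∀ α β, Finsupp.weight w α + Finsupp.weight w β = m → v α β = 0 := by
  classical
  by_contra hcon
  push Not at hcon
  obtain ⟨α₀, β₀, h₀, h₀'⟩ := hcon
  set θ := lexExp σ with hθ
  set F : Set ((σ →₀ ℕ) × (σ →₀ ℕ)) :=
    {p | Finsupp.weight w p.1 + Finsupp.weight w p.2 = m ∧ v p.1 p.2 ≠ 0} with hF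
  have hFfin : F.Finite := (finite_weight_add_le w hw m).subset fun p hp => hp.1
  -- The support is cut down to the face `F₀` on which `θ α - θ β` is minimal. Multiplication by
  -- `z_j χ_j` adds the same exponent on both sides and does not change this difference.
  obtain ⟨p₀, hp₀F, hp₀⟩ := Set.exists_min_image F (fun p => θ p.1 - θ p.2) hFfin
    ⟨(α₀, β₀), h₀, h₀'⟩
  set δ := θ p₀.1 - θ p₀.2 with hδ
  set F₀ : Set ((σ →₀ ℕ) × (σ →₀ ℕ)) := {p | p ∈ F ∧ θ p.1 - θ p.2 = δ} with hF₀
  have hF₀fin : F₀.Finite := hFfin.subset fun p hp => hp.1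
  let e : Fin n → (σ →₀ ℕ) := fun i => Finsupp.single (z i) 1
  -- Comparison by `κ i` looks first at the exponent of `z_i`, so among the `e j` it is strictly
  -- largest at `e i`.
  let κ : Fin n → (σ →₀ ℕ) → ℤ ×ₗ Lex (Fin (Fintype.card σ) → ℤ) :=
    fun i β => toLex ((β (z i) : ℤ), θ β)
  have hκadd : ∀ i β β', κ i (β + β') = κ i β + κ i β' := by
    intro i β β'
    apply ofLex.injective
    simp [κ]
  have hκe : ∀ i j, i ≠ j → κ i (e j) < κ i (e i) := by
    intro i j hij
    rw [Prod.Lex.lt_iff]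
    left
    have : z j ≠ z i := fun h => hij (hz h).symm
    simp [κ, e, this]
  have hsplit : ∀ α β, S α β ≠ 0 → ∃ i α' β', α = α' + e i ∧ β = β' + e i ∧ v α' β' ≠ 0 := by
    intro α β h
    rw [hS] at h
    obtain ⟨i, -, hi⟩ := Finset.exists_ne_zero_of_sum_ne_zero h
    have h1 := right_ne_zero_of_mul hi
    split_ifs at h1 with h2
    · exact ⟨i, α - e i, β - e i, (tsub_add_cancel_of_le h2.1).symm,
        (tsub_add_cancel_of_le h2.2).symm, h1⟩
    · exact absurd rfl h1
  have hmax : ∀ i, ∃ p ∈ F₀, ∀ q ∈ F₀, κ i q.2 ≤ κ i p.2 := fun i =>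
    Set.exists_max_image F₀ (fun p => κ i p.2) hF₀fin ⟨p₀, hp₀F, rfl⟩
  choose p hpF hpmax using hmax
  have hwe : ∀ i, Finsupp.weight w (e i) = 1 := by
    intro i
    simp [e, Finsupp.weight_single, hwz]
  -- all second components have the same weight
  have hwt : ∀ i j, Finsupp.weight w (p i).2 = Finsupp.weight w (p j).2 := by
    intro i j
    have h1 : θ ((p i).1 + (p j).2) = θ ((p j).1 + (p i).2) := by
      have := (hpF i).2.trans (hpF j).2.symm
      rw [map_add, map_add]
      rw [sub_eq_sub_iff_add_eq_add] at this
      exact this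
    have h2 := congrArg (Finsupp.weight w) (lexExp_injective σ h1)
    have h3 := (hpF i).1.1
    have h4 := (hpF j).1.1
    simp only [map_add] at h2
    omega
  -- No cancellation occurs at this entry: a contribution of `j ≠ i` would come from a point of `F₀`
  -- whose second component exceeds that of `p i` in the order `κ i`.
  have hdiag : ∀ i, S ((p i).1 + e i) ((p i).2 + e i) ≠ 0 := by
    intro i
    rw [hS, Finset.sum_eq_single i]
    · rw [if_pos ⟨le_add_self, le_add_self⟩]
      change s i * v ((p i).1 + e i - e i) ((p i).2 + e i - e i) ≠ 0
      rw [add_tsub_cancel_right, add_tsub_cancel_right]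
      exact mul_ne_zero (hs i) (hpF i).1.2
    · intro j _ hji
      by_contra hne
      have h1 := right_ne_zero_of_mul hne
      split_ifs at h1 with h2
      swap
      · exact h1 rfl
      change v ((p i).1 + e i - e j) ((p i).2 + e i - e j) ≠ 0 at h1
      obtain ⟨α', hα'⟩ : ∃ α', (p i).1 + e i = α' + e j := ⟨_, (tsub_add_cancel_of_le h2.1).symm⟩
      obtain ⟨β', hβ'⟩ : ∃ β', (p i).2 + e i = β' + e j := ⟨_, (tsub_add_cancel_of_le h2.2).symm⟩
      rw [hα', hβ', add_tsub_cancel_right, add_tsub_cancel_right] at h1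
      have hmem : (α', β') ∈ F₀ := by
        have w1 := congrArg (Finsupp.weight w) hα'
        have w2 := congrArg (Finsupp.weight w) hβ'
        have w3 := (hpF i).1.1
        simp only [map_add, hwe] at w1 w2
        refine ⟨⟨by simp only; omega, h1⟩, ?_⟩
        have t1 := congrArg θ hα'
        have t2 := congrArg θ hβ'
        have t3 := (hpF i).2
        simp only [map_add] at t1 t2
        rw [← t3]
        simp only
        rw [eq_sub_of_add_eq t1.symm, eq_sub_of_add_eq t2.symm]
        abel
      have h3 := hpmax i _ hmem
      have h4 := congrArg (κ i) hβ'
      rw [hκadd, hκadd] at h4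
      have h5 := add_lt_add_of_le_of_lt h3 (hκe i j hji.symm)
      exact absurd h4 h5.ne'
    · simp
  have hβne : ∀ i j, i ≠ j → θ ((p i).2 + e i) ≠ θ ((p j).2 + e j) := by
    intro i j hij h
    by_cases hle : κ i ((p j).2 + e j) < κ i ((p i).2 + e i)
    · rw [lexExp_injective σ h] at hle
      exact lt_irrefl _ hle
    · apply hle
      rw [hκadd, hκadd]
      exact add_lt_add_of_le_of_lt (hpmax i _ (hpF j)) (hκe i j hij)
  -- Minimality of `δ` makes the `n × n` matrix of the entries `S ((p i).1 + e i) ((p j).2 + e j)`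
  -- triangular for the order of the columns by `θ`. With the nonzero diagonal its rank is `n`,
  -- while `hR` bounds the rank by `k`.
  have htri : ∀ i j, S ((p i).1 + e i) ((p j).2 + e j) ≠ 0 →
      θ ((p j).2 + e j) ≤ θ ((p i).2 + e i) := by
    intro i j h
    obtain ⟨l, α', β', h1, h2, h3⟩ := hsplit _ _ h
    have hmem : (α', β') ∈ F := by
      have w1 := congrArg (Finsupp.weight w) h1
      have w2 := congrArg (Finsupp.weight w) h2
      have w3 := (hpF i).1.1
      have w4 := hwt i j
      simp only [map_add, hwe] at w1 w2
      exact ⟨by simp only; omega, h3⟩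
    have h4 := hp₀ _ hmem
    simp only at h4
    have t1 := congrArg θ h1
    have t2 := congrArg θ h2
    have t3 := (hpF i).2
    simp only [map_add] at t1 t2 ⊢
    rw [eq_sub_of_add_eq t1.symm, eq_sub_of_add_eq t2.symm, ← t3] at h4
    rw [← sub_nonneg] at h4 ⊢
    convert h4 using 1
    abel
  -- a vanishing combination of the rows
  obtain ⟨c, hc0, hc⟩ : ∃ c : Fin n → ℂ, c ≠ 0 ∧
      ∀ l, ∑ i, c i * a l ((p i).1 + e i) = 0 := by
    let L : (Fin n → ℂ) →ₗ[ℂ] (Fin k → ℂ) :=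
      LinearMap.pi fun l => ∑ i, a l ((p i).1 + e i) • LinearMap.proj i
    obtain ⟨c, hc, hc0⟩ := Submodule.exists_mem_ne_zero_of_ne_bot
      (LinearMap.ker_ne_bot_of_finrank_lt (f := L) (by simpa using hk))
    refine ⟨c, hc0, fun l => ?_⟩
    have := congrFun (LinearMap.mem_ker.mp hc) l
    simpa [L, mul_comm] using this
  have hrow : ∀ j, ∑ i, c i * S ((p i).1 + e i) ((p j).2 + e j) = 0 := by
    intro j
    have : ∀ i, S ((p i).1 + e i) ((p j).2 + e j) =
        ∑ l, a l ((p i).1 + e i) * b l ((p j).2 + e j) := by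
      intro i
      apply hR
      have w3 := (hpF i).1.1
      have w4 := hwt i j
      simp only [map_add, hwe]
      omega
    simp only [this, Finset.mul_sum]
    rw [Finset.sum_comm]
    apply Finset.sum_eq_zero
    intro l _
    simp only [← mul_assoc]
    rw [← Finset.sum_mul, hc, zero_mul]
  obtain ⟨i₀, hi₀⟩ := Function.ne_iff.mp hc0
  -- In the column of the largest index that occurs in the combination, triangularity leaves only
  -- the diagonal entry.
  obtain ⟨j₀, hj₀, hj₀max⟩ := Set.exists_max_image {i | c i ≠ 0} (fun i => θ ((p i).2 + e i))
    (Set.toFinite _) ⟨i₀, hi₀⟩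
  have h1 := hrow j₀
  rw [Finset.sum_eq_single j₀] at h1
  · exact mul_ne_zero hj₀ (hdiag j₀) h1
  · intro i _ hij
    by_contra hne
    have h2 := htri _ _ (right_ne_zero_of_mul hne)
    have h3 := hj₀max i (left_ne_zero_of_mul hne)
    exact hβne i j₀ hij (le_antisymm h3 h2)
  · simp

end FormalCR

namespace FormalCR

open MvPowerSeries

/-! ### Coefficients in the separated variables `Z` and `Z̄` -/

section Coefficients

variable {n : ℕ}

theorem coeff_hol (f : HolSeries n) (α β : Coord n →₀ ℕ) :
    coeff (α.sumElim β) (hol f) = if β = 0 then coeff α f else 0 := by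
  split_ifs with h
  · subst h
    have := coeff_embDomain_rename (Function.Embedding.inl (α := Coord n) (β := Coord n)) f α
    rw [Finsupp.embDomain_inl] at this
    exact this
  · apply coeff_rename_eq_zero
    rintro ⟨x, hx⟩
    apply h
    ext i
    have := DFunLike.congr_fun hx (Sum.inr i)
    rw [Finsupp.mapDomain_of_notMem_range _ _ (by simp)] at this
    simpa using this.symm

theorem coeff_antihol (f : HolSeries n) (α β : Coord n →₀ ℕ) :
    coeff (α.sumElim β) (antihol f) = if α = 0 then starRingEnd ℂ (coeff β f) else 0 := by
  split_ifs with h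
  · subst h
    have := coeff_embDomain_rename (Function.Embedding.inr (α := Coord n) (β := Coord n))
      (map (starRingEnd ℂ) f) β
    rw [Finsupp.embDomain_inr, coeff_map] at this
    exact this
  · apply coeff_rename_eq_zero
    rintro ⟨x, hx⟩
    apply h
    ext i
    have := DFunLike.congr_fun hx (Sum.inl i)
    rw [Finsupp.mapDomain_of_notMem_range _ _ (by simp)] at this
    simpa using this.symm

theorem coeff_sumElim_mul (A B : MixedSeries n) (α β : Coord n →₀ ℕ) :
    coeff (α.sumElim β) (A * B) =
      ∑ x ∈ Finset.HasAntidiagonal.antidiagonal α, ∑ y ∈ Finset.HasAntidiagonal.antidiagonal β,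
        coeff (x.1.sumElim y.1) A * coeff (x.2.sumElim y.2) B := by
  classical
  rw [coeff_mul, ← Finsupp.image_sumElim_product_antidiagonal, Finset.sum_image,
    Finset.sum_product]
  rintro ⟨⟨x, y⟩, z, w⟩ - ⟨⟨x', y'⟩, z', w'⟩ - h
  simp only [Prod.mk.injEq] at h ⊢
  have hinj : ∀ {a b c d : Coord n →₀ ℕ}, a.sumElim b = c.sumElim d → a = c ∧ b = d := by
    intro a b c d h
    constructor
    · ext i
      exact DFunLike.congr_fun h (Sum.inl i)
    · ext i
      exact DFunLike.congr_fun h (Sum.inr i)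
  obtain ⟨h1, h2⟩ := hinj h.1
  obtain ⟨h3, h4⟩ := hinj h.2
  exact ⟨⟨h1, h3⟩, h2, h4⟩

/-- The coefficients of `f(Z)` times the conjugate of `g(Z)` form an array of rank at most one. This
is how the number of components of `φ` bounds the rank of `hermSq s φ`. -/
theorem coeff_hol_mul_antihol (f g : HolSeries n) (α β : Coord n →₀ ℕ) :
    coeff (α.sumElim β) (hol f * antihol g) = coeff α f * starRingEnd ℂ (coeff β g) := by
  rw [coeff_sumElim_mul, Finset.sum_eq_single (α, 0)]
  · rw [Finset.sum_eq_single (0, β)]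
    · simp [coeff_hol, coeff_antihol]
    · rintro ⟨x, y⟩ h hne
      have h' : x + y = β := Finset.HasAntidiagonal.mem_antidiagonal.mp h
      have hx : x ≠ 0 := by
        rintro rfl
        exact hne (by rw [← h', zero_add])
      simp [coeff_hol, hx]
    · simp
  · rintro ⟨x, y⟩ h hne
    have h' : x + y = α := Finset.HasAntidiagonal.mem_antidiagonal.mp h
    have hy : y ≠ 0 := by
      rintro rfl
      exact hne (by rw [← h', add_zero])
    exact Finset.sum_eq_zero fun z _ => by simp [coeff_antihol, hy]
  · simp

theorem ext_sumElim {A B : MixedSeries n}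
    (h : ∀ α β : Coord n →₀ ℕ, coeff (α.sumElim β) A = coeff (α.sumElim β) B) : A = B := by
  ext d
  rw [← Finsupp.comapDomain_sumElim_comapDomain d]
  exact h _ _

theorem coeff_hermSq {k : ℕ} (s : ℕ) (φ : Fin k → HolSeries n) (α β : Coord n →₀ ℕ) :
    coeff (α.sumElim β) (hermSq s φ) =
      ∑ j, sgn s j * (coeff α (φ j) * starRingEnd ℂ (coeff β (φ j))) := by
  simp only [hermSq, map_sum, coeff_C_mul, coeff_hol_mul_antihol]

theorem hol_add (f g : HolSeries n) : hol (f + g) = hol f + hol g := map_add _ f g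
theorem hol_sub (f g : HolSeries n) : hol (f - g) = hol f - hol g := map_sub _ f g
theorem hol_mul (f g : HolSeries n) : hol (f * g) = hol f * hol g := map_mul _ f g
theorem hol_C (c : ℂ) : hol (C c : HolSeries n) = C c := by simp [hol]
theorem hol_one : hol (1 : HolSeries n) = 1 := map_one _
theorem hol_sum {ι : Type*} (t : Finset ι) (f : ι → HolSeries n) :
    hol (∑ i ∈ t, f i) = ∑ i ∈ t, hol (f i) := map_sum _ f t
theorem antihol_add (f g : HolSeries n) : antihol (f + g) = antihol f + antihol g := by
  simp [antihol]
theorem antihol_sub (f g : HolSeries n) : antihol (f - g) = antihol f - antihol g := by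
  simp [antihol]
theorem antihol_mul (f g : HolSeries n) : antihol (f * g) = antihol f * antihol g := by
  simp [antihol]
theorem antihol_C (c : ℂ) : antihol (C c : HolSeries n) = C (starRingEnd ℂ c) := by simp [antihol]
theorem antihol_one : antihol (1 : HolSeries n) = 1 := by simp [antihol]
theorem antihol_sum {ι : Type*} (t : Finset ι) (f : ι → HolSeries n) :
    antihol (∑ i ∈ t, f i) = ∑ i ∈ t, antihol (f i) := by
  simp [antihol]

theorem constantCoeff_hol (f : HolSeries n) : constantCoeff (hol f) = constantCoeff f := by
  simp [hol]
theorem constantCoeff_antihol (f : HolSeries n) :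
    constantCoeff (antihol f) = starRingEnd ℂ (constantCoeff f) := by
  rw [antihol, constantCoeff_rename, constantCoeff_map]

end Coefficients

/-! ### Composition and pullback of formal series -/

section Composition

variable {m n p : ℕ}

theorem FixesZero.hasSubst {H : FormalMap m n} (hH : FixesZero H) : HasSubst H :=
  hasSubst_of_constantCoeff_zero hH

theorem FixesZero.hasSubst_mixed {H : FormalMap m n} (hH : FixesZero H) :
    HasSubst (Sum.elim (fun i => hol (H i)) (fun i => antihol (H i)) :
      Coord n ⊕ Coord n → MixedSeries m) := by
  apply hasSubst_of_constantCoeff_zero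
  rintro (i | i)
  · simp [constantCoeff_hol, hH i]
  · simp [constantCoeff_antihol, hH i]

theorem pullback_sub {H : FormalMap m n} (hH : FixesZero H) (A B : MixedSeries n) :
    pullback H (A - B) = pullback H A - pullback H B := subst_sub hH.hasSubst_mixed A B
theorem pullback_mul {H : FormalMap m n} (hH : FixesZero H) (A B : MixedSeries n) :
    pullback H (A * B) = pullback H A * pullback H B := subst_mul hH.hasSubst_mixed A B
theorem pullback_C {H : FormalMap m n} (c : ℂ) :
    pullback H (C c) = C c := subst_C c
theorem pullback_sum {H : FormalMap m n} (hH : FixesZero H) {ι : Type*} (t : Finset ι)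
    (f : ι → MixedSeries n) : pullback H (∑ i ∈ t, f i) = ∑ i ∈ t, pullback H (f i) := by
  unfold pullback
  rw [← coe_substAlgHom hH.hasSubst_mixed, map_sum]

theorem constantCoeff_subst_fixesZero {H : FormalMap m n} (hH : FixesZero H) (f : HolSeries n) :
    constantCoeff (subst H f) = constantCoeff f := by
  have h0 := constantCoeff_subst_eq_zero hH.hasSubst hH (f := f - C (constantCoeff f)) (by simp)
  rw [subst_sub hH.hasSubst, map_sub, subst_C, constantCoeff_C, sub_eq_zero] at h0
  exact h0

theorem FixesZero.comp {T : FormalMap n p} {H : FormalMap m n} (hT : FixesZero T)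
    (hH : FixesZero H) : FixesZero (comp T H) := fun i => by
  rw [FormalCR.comp, constantCoeff_subst_fixesZero hH, hT i]

theorem hol_eq_subst (f : HolSeries n) : hol f = subst (X ∘ Sum.inl) f := rename_eq_subst _ f
theorem antihol_eq_subst (f : HolSeries n) :
    antihol f = subst (X ∘ Sum.inr) (map (starRingEnd ℂ) f) := rename_eq_subst _ _

theorem pullback_hol {H : FormalMap m n} (hH : FixesZero H) (f : HolSeries n) :
    pullback H (hol f) = hol (subst H f) := by
  unfold pullback
  rw [hol_eq_subst, hol_eq_subst, subst_comp_subst_apply (HasSubst.X_comp _) hH.hasSubst_mixed,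
    subst_comp_subst_apply hH.hasSubst (HasSubst.X_comp _)]
  congr 1
  funext i
  simp only [Function.comp]
  rw [subst_X hH.hasSubst_mixed, Sum.elim_inl, hol_eq_subst]

theorem pullback_antihol {H : FormalMap m n} (hH : FixesZero H) (f : HolSeries n) :
    pullback H (antihol f) = antihol (subst H f) := by
  have hH' : HasSubst fun i => map (starRingEnd ℂ) (H i) := by
    apply hasSubst_of_constantCoeff_zero
    intro i
    have := hH i
    simp [constantCoeff_map, this]
  unfold pullback
  have h1 : map (starRingEnd ℂ) (subst H f) =
      subst (fun i => map (starRingEnd ℂ) (H i)) (map (starRingEnd ℂ) f) :=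
    map_subst hH.hasSubst f
  rw [antihol_eq_subst, antihol_eq_subst, h1, subst_comp_subst_apply (HasSubst.X_comp _)
    hH.hasSubst_mixed, subst_comp_subst_apply hH' (HasSubst.X_comp _)]
  congr 1
  funext i
  simp only [Function.comp]
  rw [subst_X hH.hasSubst_mixed, Sum.elim_inr, antihol_eq_subst]

theorem comp_assoc {q : ℕ} {S : FormalMap p q} {T : FormalMap n p} {H : FormalMap m n}
    (hT : FixesZero T) (hH : FixesZero H) : comp (comp S T) H = comp S (comp T H) := by
  funext i
  exact subst_comp_subst_apply hT.hasSubst hH.hasSubst (S i)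

theorem pullback_hermSq {H : FormalMap m n} (hH : FixesZero H) {k : ℕ} (s : ℕ)
    (φ : Fin k → HolSeries n) :
    pullback H (hermSq s φ) = hermSq s fun j => subst H (φ j) := by
  unfold hermSq
  rw [pullback_sum hH]
  simp only [pullback_mul hH, pullback_C, pullback_hol hH, pullback_antihol hH]

theorem pullback_quadricSeries {H : FormalMap m n} (hH : FixesZero H) (ℓ : ℕ) :
    pullback H (quadricSeries n ℓ) =
      C (1 / (2 * Complex.I)) * (hol (H (Sum.inr ())) - antihol (H (Sum.inr ())))
        - hermSq ℓ (fun j => H (Sum.inl j)) := by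
  unfold quadricSeries
  rw [pullback_sub hH, pullback_mul hH, pullback_sub hH, pullback_C, pullback_hol hH,
    pullback_antihol hH, pullback_hermSq hH]
  simp only [subst_X hH.hasSubst]

theorem pullback_pullback {T : FormalMap n p} {H : FormalMap m n} (hT : FixesZero T)
    (hH : FixesZero H) (A : MixedSeries p) :
    pullback H (pullback T A) = pullback (comp T H) A := by
  unfold pullback
  rw [subst_comp_subst_apply hT.hasSubst_mixed hH.hasSubst_mixed]
  congr 1
  funext i
  rcases i with i | i
  · exact pullback_hol hH (T i)
  · exact pullback_antihol hH (T i)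

theorem exists_eq_single_add {σ : Type*} {d : σ →₀ ℕ} {m : ℕ} (h : d.degree = m + 1) :
    ∃ i d', d = Finsupp.single i 1 + d' ∧ d'.degree = m := by
  obtain ⟨i, hi⟩ : ∃ i, d i ≠ 0 := by
    by_contra hcon
    push Not at hcon
    have : d = 0 := by ext i; simpa using hcon i
    simp [this] at h
  have h1 : Finsupp.single i 1 ≤ d := by
    rw [Finsupp.single_le_iff]
    omega
  obtain ⟨c, rfl⟩ := exists_add_of_le h1
  refine ⟨i, c, rfl, ?_⟩
  rw [map_add, Finsupp.degree_single] at h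
  omega

theorem exists_eq_single_of_degree_eq_one {σ : Type*} {d : σ →₀ ℕ} (h : d.degree = 1) :
    ∃ i, d = Finsupp.single i 1 := by
  obtain ⟨i, d', rfl, hd'⟩ := exists_eq_single_add h
  exact ⟨i, by rw [(Finsupp.degree_eq_zero_iff d').mp hd', add_zero]⟩

/-- Linear terms of a composition. -/
theorem coeff_single_subst {H : FormalMap m n} (hH : FixesZero H) (f : HolSeries n)
    (j : Coord m) : coeff (Finsupp.single j 1) (subst H f) =
      ∑ i, coeff (Finsupp.single i 1) f * coeff (Finsupp.single j 1) (H i) := by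
  classical
  set r : HolSeries n := f - C (constantCoeff f) - ∑ i, C (coeff (Finsupp.single i 1) f) * X i
    with hr
  have hr2 : 2 ≤ r.order := by
    apply le_order
    intro d hd
    have hd' : d.degree < 2 := by exact_mod_cast hd
    by_cases h0 : d.degree = 0
    · rw [Finsupp.degree_eq_zero_iff] at h0
      subst h0
      simp [hr]
    · have h1 : d.degree = 1 := by omega
      obtain ⟨i, rfl⟩ : ∃ i, d = Finsupp.single i 1 := by
        exact exists_eq_single_of_degree_eq_one h1
      rw [hr]
      simp only [map_sub, map_sum, coeff_C_mul, coeff_index_single_X]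
      rw [coeff_C_of_ne_zero (by simp)]
      simp
  have h1 : coeff (Finsupp.single j 1) (subst H r) = 0 := by
    apply coeff_of_lt_order
    refine lt_of_lt_of_le ?_ (le_order_subst hH.hasSubst r)
    have h2 : (1 : ℕ∞) ≤ ⨅ i, (H i).order := le_iInf fun i =>
      one_le_order_iff_constCoeff_eq_zero.mpr (hH i)
    refine lt_of_lt_of_le ?_ (mul_le_mul' h2 hr2)
    simp
  have h3 : f = r + (C (constantCoeff f) + ∑ i, C (coeff (Finsupp.single i 1) f) * X i) := by
    rw [hr]; ring
  conv_lhs => rw [h3]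
  rw [subst_add hH.hasSubst, subst_add hH.hasSubst, map_add, map_add, h1, subst_C,
    coeff_C_of_ne_zero (by simp), ← coe_substAlgHom hH.hasSubst, map_sum, map_sum]
  simp only [zero_add, map_mul, coe_substAlgHom, subst_X hH.hasSubst, subst_C, coeff_C_mul]

theorem jac_comp {T : FormalMap n p} {H : FormalMap m n} (hH : FixesZero H) :
    jac (comp T H) = jac T * jac H := by
  ext i j
  simp only [jac, comp, Matrix.of_apply, Matrix.mul_apply, coeff_single_subst hH]

end Composition

end FormalCR

namespace FormalCR

open MvPowerSeries

/-! ### Weighted orders and lowest order terms -/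

section Weights

variable {n : ℕ}

/-- The variables `z` have weight one, and `w` has weight three. -/
def coordWeight (n : ℕ) : Coord n → ℕ := Sum.elim (fun _ => 1) (fun _ => 3)

/-- The weights of the variables `(Z, Z̄)`. -/
def mixedWeight (n : ℕ) : Coord n ⊕ Coord n → ℕ := Sum.elim (coordWeight n) (coordWeight n)

theorem coordWeight_pos (i : Coord n) : 0 < coordWeight n i := by
  rcases i with i | i <;> simp [coordWeight]

theorem weight_sumElim (α β : Coord n →₀ ℕ) : Finsupp.weight (mixedWeight n) (α.sumElim β) =
    Finsupp.weight (coordWeight n) α + Finsupp.weight (coordWeight n) β := by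
  simp only [Finsupp.weight_eq_sum, Fintype.sum_sum_type, mixedWeight, Finsupp.sumElim_inl,
    Finsupp.sumElim_inr, Sum.elim_inl, Sum.elim_inr]

theorem degree_le_weight (α : Coord n →₀ ℕ) :
    α.degree ≤ Finsupp.weight (coordWeight n) α := by
  rw [Finsupp.degree_eq_sum, Finsupp.weight_eq_sum]
  apply Finset.sum_le_sum
  intro i _
  simpa using Nat.le_mul_of_pos_right (α i) (coordWeight_pos i)

theorem coeff_eq_zero_of_degree_lt_two {f : HolSeries n} (hf : 2 ≤ f.order) {α : Coord n →₀ ℕ}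
    (hα : α.degree < 2) : coeff α f = 0 :=
  coeff_of_lt_order (lt_of_lt_of_le (by exact_mod_cast hα) hf)

theorem sgn_ne_zero (ℓ : ℕ) {m : ℕ} (j : Fin m) : sgn ℓ j ≠ 0 := by
  unfold sgn; split_ifs <;> simp

theorem conj_sgn (ℓ : ℕ) {m : ℕ} (j : Fin m) : starRingEnd ℂ (sgn ℓ j) = sgn ℓ j := by
  unfold sgn; split_ifs <;> simp

theorem coeff_quadricSeries (ℓ : ℕ) (α β : Coord n →₀ ℕ) :
    coeff (α.sumElim β) (quadricSeries n ℓ) =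
      1 / (2 * Complex.I) * ((if β = 0 then coeff α (X (Sum.inr ()) : HolSeries n) else 0) -
        (if α = 0 then coeff β (X (Sum.inr ()) : HolSeries n) else 0)) -
      ∑ j, sgn ℓ j * (coeff α (X (Sum.inl j) : HolSeries n) * coeff β (X (Sum.inl j))) := by
  classical
  simp only [quadricSeries, map_sub, coeff_C_mul, coeff_hol, coeff_antihol, coeff_hermSq]
  simp only [coeff_X, apply_ite (starRingEnd ℂ), map_one, map_zero]

/-- With `w` of weight three, rather than the usual two, `Im w` becomes an error term. The lowest
part of the equation of the hypersurface is then `-⟨z, z̄⟩` alone, to which the rank estimate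
applies. -/
theorem le_weightedOrder_quadric_remainder (ℓ : ℕ) {k : ℕ} (s : ℕ) (φ : Fin k → HolSeries n)
    (hφ : ∀ j, 2 ≤ (φ j).order) :
    3 ≤ (quadricSeries n ℓ - hermSq s φ +
      hermSq ℓ fun j => X (Sum.inl j)).weightedOrder (mixedWeight n) := by
  classical
  apply le_weightedOrder
  intro d hd
  rw [← Finsupp.comapDomain_sumElim_comapDomain d] at hd ⊢
  generalize d.comapDomain Sum.inl _ = α at *
  generalize d.comapDomain Sum.inr _ = β at *
  rw [weight_sumElim] at hd
  have hd' : Finsupp.weight (coordWeight n) α + Finsupp.weight (coordWeight n) β < 3 := by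
    exact_mod_cast hd
  have hα := degree_le_weight α
  have hβ := degree_le_weight β
  have hw : Finsupp.weight (coordWeight n) (Finsupp.single (Sum.inr ()) 1) = 3 := by
    simp [Finsupp.weight_single, coordWeight]
  rw [quadricSeries]
  have h1 : coeff α (X (Sum.inr ()) : HolSeries n) = 0 := by
    rw [coeff_X, if_neg]
    rintro rfl
    omega
  have h2 : coeff β (X (Sum.inr ()) : HolSeries n) = 0 := by
    rw [coeff_X, if_neg]
    rintro rfl
    omega
  simp only [map_sub, map_add, coeff_C_mul, coeff_hol, coeff_antihol, h1, h2]
  have h3 : coeff (α.sumElim β) (hermSq s φ) = 0 := by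
    rw [coeff_hermSq]
    apply Finset.sum_eq_zero
    intro j _
    by_cases h : α.degree < 2
    · simp [coeff_eq_zero_of_degree_lt_two (hφ j) h]
    · have : β.degree < 2 := by omega
      simp [coeff_eq_zero_of_degree_lt_two (hφ j) this]
  simp [h3]

/-- The lowest order terms of a product with the equation of a hypersurface close to a
quadric. -/
theorem coeff_mul_quadric_of_weight_le (ℓ : ℕ) {k : ℕ} (s : ℕ) (φ : Fin k → HolSeries n)
    (hφ : ∀ j, 2 ≤ (φ j).order) (V : MixedSeries n) (m : ℕ)
    (hV : m ≤ V.weightedOrder (mixedWeight n)) (α β : Coord n →₀ ℕ)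
    (h : Finsupp.weight (coordWeight n) α + Finsupp.weight (coordWeight n) β ≤ m + 2) :
    coeff (α.sumElim β) (V * (quadricSeries n ℓ - hermSq s φ)) =
      ∑ j, -sgn ℓ j * (if Finsupp.single (Sum.inl j) 1 ≤ α ∧ Finsupp.single (Sum.inl j) 1 ≤ β
        then coeff ((α - Finsupp.single (Sum.inl j) 1).sumElim
          (β - Finsupp.single (Sum.inl j) 1)) V else 0) := by
  classical
  have h1 : V * (quadricSeries n ℓ - hermSq s φ) =
      V * (quadricSeries n ℓ - hermSq s φ + hermSq ℓ fun j => X (Sum.inl j)) -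
        V * hermSq ℓ fun j => X (Sum.inl j) := by ring
  have h2 : coeff (α.sumElim β)
      (V * (quadricSeries n ℓ - hermSq s φ + hermSq ℓ fun j => X (Sum.inl j))) = 0 := by
    apply coeff_eq_zero_of_lt_weightedOrder (mixedWeight n)
    refine lt_of_lt_of_le ?_ (le_weightedOrder_mul (mixedWeight n))
    refine lt_of_lt_of_le ?_ (add_le_add hV (le_weightedOrder_quadric_remainder ℓ s φ hφ))
    rw [weight_sumElim]
    have : Finsupp.weight (coordWeight n) α + Finsupp.weight (coordWeight n) β < m + 3 := by omega
    exact_mod_cast this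
  rw [h1, map_sub, h2, zero_sub, hermSq, Finset.mul_sum, map_sum, ← Finset.sum_neg_distrib]
  apply Finset.sum_congr rfl
  intro j _
  have h3 : hol (X (Sum.inl j) : HolSeries n) * antihol (X (Sum.inl j)) =
      monomial ((Finsupp.single (Sum.inl j) 1).sumElim (Finsupp.single (Sum.inl j) 1)) 1 := by
    simp only [hol, antihol, map_X, rename_X]
    rw [X, X, monomial_mul_monomial, Finsupp.sumElim_single_single, one_mul]
  rw [h3, mul_left_comm, coeff_C_mul, coeff_mul_monomial, neg_mul, mul_one]
  congr 2
  have h4 : (Finsupp.single (Sum.inl j) 1 : Coord n →₀ ℕ).sumElim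
      (Finsupp.single (Sum.inl j) 1 : Coord n →₀ ℕ) ≤ α.sumElim β ↔
      Finsupp.single (Sum.inl j) 1 ≤ α ∧ Finsupp.single (Sum.inl j) 1 ≤ β := by
    constructor
    · intro h
      exact ⟨fun i => h (Sum.inl i), fun i => h (Sum.inr i)⟩
    · rintro ⟨h, h'⟩ (i | i)
      · exact h i
      · exact h' i
  have h5 : α.sumElim β - (Finsupp.single (Sum.inl j) 1 : Coord n →₀ ℕ).sumElim
      (Finsupp.single (Sum.inl j) 1 : Coord n →₀ ℕ) =
      (α - Finsupp.single (Sum.inl j) 1).sumElim (β - Finsupp.single (Sum.inl j) 1) := by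
    ext (i | i) <;> rfl
  simp only [h4, h5]

theorem coeff_sumElim_zero_mul {V : MixedSeries n} (hV : ∀ α : Coord n →₀ ℕ, coeff (α.sumElim 0) V = 0)
    (P : MixedSeries n) (α : Coord n →₀ ℕ) : coeff (α.sumElim 0) (V * P) = 0 := by
  rw [coeff_sumElim_mul]
  refine Finset.sum_eq_zero fun x _ => Finset.sum_eq_zero fun y hy => ?_
  have h : y.1 + y.2 = 0 := Finset.HasAntidiagonal.mem_antidiagonal.mp hy
  rw [(add_eq_zero.mp h).1, hV, zero_mul]

end Weights

end FormalCR

namespace FormalCR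

open MvPowerSeries

/-! ### Rigidity of maps between graphs of small codimension -/

section Rigidity

variable {n : ℕ}

/-- The coefficients of the difference of the equations of two quadrics, in terms of the
deviation of the map from the identity. -/
theorem coeff_quadric_deviation (ℓ : ℕ) (p : Fin n → HolSeries n) (q : HolSeries n)
    (α β : Coord n →₀ ℕ) :
    coeff (α.sumElim β) (C (1 / (2 * Complex.I)) *
        (hol (X (Sum.inr ())) * antihol (1 + q) - hol (1 + q) * antihol (X (Sum.inr ())))
      - hermSq ℓ (fun j => X (Sum.inl j) + p j) - quadricSeries n ℓ) =
    1 / (2 * Complex.I) * (coeff α (X (Sum.inr ()) : HolSeries n) * starRingEnd ℂ (coeff β q)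
        - coeff α q * coeff β (X (Sum.inr ()) : HolSeries n))
      - ∑ j, sgn ℓ j * (coeff α (X (Sum.inl j) : HolSeries n) * starRingEnd ℂ (coeff β (p j))
        + coeff α (p j) * coeff β (X (Sum.inl j) : HolSeries n)
        + coeff α (p j) * starRingEnd ℂ (coeff β (p j))) := by
  classical
  have hX : ∀ (i : Coord n), starRingEnd ℂ (coeff β (X i : HolSeries n)) = coeff β (X i) := by
    intro i
    rw [coeff_X]
    split_ifs <;> simp
  have h1 : C (1 / (2 * Complex.I)) *
        (hol (X (Sum.inr ())) * antihol (1 + q) - hol (1 + q) * antihol (X (Sum.inr ())))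
      - hermSq ℓ (fun j => X (Sum.inl j) + p j) - quadricSeries n ℓ =
      C (1 / (2 * Complex.I)) * (hol (X (Sum.inr ())) * antihol q
        - hol q * antihol (X (Sum.inr ()))) - (hermSq ℓ (fun j => X (Sum.inl j) + p j)
        - hermSq ℓ fun j => X (Sum.inl j)) := by
    rw [quadricSeries, antihol_add, hol_add, hol_one, antihol_one]
    ring
  rw [h1, map_sub, map_sub, coeff_C_mul, map_sub, coeff_hol_mul_antihol, coeff_hol_mul_antihol,
    coeff_hermSq, coeff_hermSq, hX, ← Finset.sum_sub_distrib]
  congr 1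
  apply Finset.sum_congr rfl
  intro j _
  rw [map_add, map_add, map_add, hX]
  ring

/-- A map between two hypersurfaces `Im w = ⟨z, z̄⟩ + ⟨φ, φ̄⟩` in normal form, whose codimensions
have a small sum, is the identity up to a real dilation parameter `r` of the quadric. -/
theorem eq_of_mul_quadric_eq {k₁ k₂ : ℕ} (hk : k₁ + k₂ < n) (ℓ s₁ s₂ : ℕ)
    (φ₁ : Fin k₁ → HolSeries n) (φ₂ : Fin k₂ → HolSeries n)
    (hφ₁ : ∀ j, 2 ≤ (φ₁ j).order) (hφ₂ : ∀ j, 2 ≤ (φ₂ j).order)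
    (h g : HolSeries n) (f : Fin n → HolSeries n) (U : MixedSeries n)
    (hh : constantCoeff h = 1) (hg : constantCoeff g = 0)
    (hf : ∀ j, 2 ≤ (f j - X (Sum.inl j)).order)
    (hU : ∀ α : Coord n →₀ ℕ, coeff (α.sumElim 0) (U - 1) = 0)
    (hE : U * (quadricSeries n ℓ - hermSq s₁ φ₁) =
      C (1 / (2 * Complex.I)) * (hol g * antihol h - hol h * antihol g)
        - hermSq ℓ f - hermSq s₂ φ₂) :
    g = X (Sum.inr ()) ∧ (∀ j, f j = X (Sum.inl j)) ∧
      (∃ r : ℝ, h = 1 + C (r : ℂ) * X (Sum.inr ())) ∧ hermSq s₁ φ₁ = hermSq s₂ φ₂ := by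
  classical
  have hI : (1 / (2 * Complex.I) : ℂ) ≠ 0 := by simp
  have hf0 : ∀ j, coeff 0 (f j) = 0 := by
    intro j
    have := coeff_eq_zero_of_degree_lt_two (hf j) (α := 0) (by simp)
    simpa using this
  have hφ0 : ∀ {k : ℕ} (s : ℕ) (φ : Fin k → HolSeries n), (∀ j, 2 ≤ (φ j).order) →
      ∀ α β : Coord n →₀ ℕ, β.degree < 2 → coeff (α.sumElim β) (hermSq s φ) = 0 := by
    intro k s φ hφ α β hβ
    rw [coeff_hermSq]
    apply Finset.sum_eq_zero
    intro j _
    simp [coeff_eq_zero_of_degree_lt_two (hφ j) hβ]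
  -- the last component
  have hgw : g = X (Sum.inr ()) := by
    ext α
    -- On terms without `Z̄` the factor `U` acts as `1`, and the Hermitian squares disappear because
    -- their components vanish at the origin. With `h(0) = 1` and `g(0) = 0` only `g` and `w`
    -- remain.
    have h1 := congrArg (coeff (α.sumElim 0)) hE
    have h2 : U * (quadricSeries n ℓ - hermSq s₁ φ₁) = (U - 1) * (quadricSeries n ℓ - hermSq s₁ φ₁)
        + (quadricSeries n ℓ - hermSq s₁ φ₁) := by ring
    have h3 : coeff (α.sumElim 0) (hermSq ℓ f) = 0 := by
      rw [coeff_hermSq]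
      apply Finset.sum_eq_zero
      intro j _
      rw [hf0]
      simp
    rw [h2, map_add, coeff_sumElim_zero_mul hU, map_sub, hφ0 s₁ φ₁ hφ₁ _ _ (by simp),
      coeff_quadricSeries, map_sub, map_sub, h3, hφ0 s₂ φ₂ hφ₂ _ _ (by simp), coeff_C_mul,
      map_sub, coeff_hol_mul_antihol, coeff_hol_mul_antihol] at h1
    simp only [coeff_zero_eq_constantCoeff, hh, hg, constantCoeff_X] at h1
    simp only [if_true, ite_self, mul_zero, map_zero, map_one, mul_one, sub_zero, zero_add,
      Finset.sum_const_zero] at h1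
    exact (mul_left_cancel₀ hI h1).symm
  subst hgw
  obtain ⟨p, hp⟩ : ∃ p : Fin n → HolSeries n, p = fun j => f j - X (Sum.inl j) := ⟨_, rfl⟩
  obtain ⟨q, hq⟩ : ∃ q : HolSeries n, q = h - 1 := ⟨_, rfl⟩
  obtain rfl : f = fun j => X (Sum.inl j) + p j := by
    funext j
    rw [hp]
    ring
  obtain rfl : h = 1 + q := by
    rw [hq]
    ring
  have hp2 : ∀ j (α : Coord n →₀ ℕ), α.degree < 2 → coeff α (p j) = 0 := by
    intro j α hα
    apply coeff_eq_zero_of_degree_lt_two _ hα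
    have := hf j
    rwa [add_sub_cancel_left] at this
  obtain ⟨V, hV⟩ : ∃ V : MixedSeries n, V = U - 1 := ⟨_, rfl⟩
  obtain ⟨E, hEdef⟩ : ∃ E : MixedSeries n, E = C (1 / (2 * Complex.I)) *
        (hol (X (Sum.inr ())) * antihol (1 + q) - hol (1 + q) * antihol (X (Sum.inr ())))
      - hermSq ℓ (fun j => X (Sum.inl j) + p j) - quadricSeries n ℓ := ⟨_, rfl⟩
  have hEc := coeff_quadric_deviation ℓ p q
  rw [← hEdef] at hEc
  rw [← hV] at hU
  have hmain : V * (quadricSeries n ℓ - hermSq s₁ φ₁) = E + hermSq s₁ φ₁ - hermSq s₂ φ₂ := by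
    rw [hV, sub_mul, hE, hEdef]
    ring
  -- the deviation vanishes up to the weight which is controlled by `V`
  have key : ∀ m : ℕ, m ≤ V.weightedOrder (mixedWeight n) →
      (∀ j α, Finsupp.weight (coordWeight n) α + 1 ≤ m + 2 → coeff α (p j) = 0) ∧
      (∀ α, Finsupp.weight (coordWeight n) α + 3 ≤ m + 2 →
        coeff α q = coeff α (X (Sum.inr ()) : HolSeries n) *
          starRingEnd ℂ (coeff (Finsupp.single (Sum.inr ()) 1) q)) ∧
      ∀ α β, Finsupp.weight (coordWeight n) α + Finsupp.weight (coordWeight n) β = m + 2 →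
        coeff (α.sumElim β) E = 0 := by
    intro m hm
    -- For `β` of degree one, dividing by `z_j χ_j` leaves a coefficient of `V` without `Z̄`, which
    -- is zero, and the squares of `φ₁`, `φ₂` have no term of degree one in `Z̄`.
    have hEzero : ∀ α β : Coord n →₀ ℕ, Finsupp.weight (coordWeight n) α +
        Finsupp.weight (coordWeight n) β ≤ m + 2 → β.degree = 1 →
        coeff (α.sumElim β) E = 0 := by
      intro α β hαβ hβ
      have h1 := congrArg (coeff (α.sumElim β)) hmain
      rw [coeff_mul_quadric_of_weight_le ℓ s₁ φ₁ hφ₁ V m hm α β hαβ, map_sub, map_add,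
        hφ0 s₁ φ₁ hφ₁ _ _ (by omega), hφ0 s₂ φ₂ hφ₂ _ _ (by omega), add_zero, sub_zero] at h1
      rw [← h1]
      apply Finset.sum_eq_zero
      intro j _
      split_ifs with hle
      · have : β - Finsupp.single (Sum.inl j) 1 = 0 := by
          obtain ⟨i, rfl⟩ := exists_eq_single_of_degree_eq_one hβ
          have h2 := (Finsupp.single_le_iff.mp hle.2)
          rw [Finsupp.single_apply] at h2
          split_ifs at h2 with h3
          · rw [h3, tsub_self]
          · omega
        rw [this, hU, mul_zero]
      · simp
    have hsw : Finsupp.weight (coordWeight n) (Finsupp.single (Sum.inr ()) 1) = 3 := by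
      simp [Finsupp.weight_single, coordWeight]
    have hsz : ∀ j : Fin n, Finsupp.weight (coordWeight n) (Finsupp.single (Sum.inl j) 1) = 1 := by
      intro j
      simp [Finsupp.weight_single, coordWeight]
    -- The coefficient of `z̄_j` in `E` isolates `p j`, since `p` has no linear terms. The exponent
    -- of `w` is treated apart because there the coefficient of `z̄_j` also involves `q`.
    have hP : ∀ j α, Finsupp.weight (coordWeight n) α + 1 ≤ m + 2 → coeff α (p j) = 0 := by
      intro j α hα
      by_cases hαw : α = Finsupp.single (Sum.inr ()) 1
      · subst hαw
        exact hp2 j _ (by simp)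
      have h1 := hEzero α (Finsupp.single (Sum.inl j) 1) (by rw [hsz]; exact hα) (by simp)
      rw [hEc, coeff_X, if_neg hαw, Finset.sum_eq_single j] at h1
      · rw [hp2 j (Finsupp.single (Sum.inl j) 1) (by simp), coeff_index_single_self_X,
          coeff_index_single_X, if_neg (by simp)] at h1
        simpa [sgn_ne_zero] using h1
      · intro i _ hij
        rw [hp2 i (Finsupp.single (Sum.inl j) 1) (by simp), coeff_index_single_X,
          if_neg (by simpa using hij.symm)]
        simp
      · simp
    -- The coefficient of `w̄` in `E` isolates `q`, up to a multiple of `w`.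
    have hQ : ∀ α, Finsupp.weight (coordWeight n) α + 3 ≤ m + 2 →
        coeff α q = coeff α (X (Sum.inr ()) : HolSeries n) *
          starRingEnd ℂ (coeff (Finsupp.single (Sum.inr ()) 1) q) := by
      intro α hα
      have h1 := hEzero α (Finsupp.single (Sum.inr ()) 1) (by rw [hsw]; exact hα) (by simp)
      rw [hEc, Finset.sum_eq_zero, coeff_index_single_self_X, sub_zero, mul_one] at h1
      · have := (mul_eq_zero.mp h1).resolve_left hI
        exact (sub_eq_zero.mp this).symm
      · intro j _
        rw [hp2 j (Finsupp.single (Sum.inr ()) 1) (by simp), coeff_index_single_X,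
          if_neg (by simp)]
        simp
    refine ⟨hP, hQ, fun α β hαβ => ?_⟩
    have hwpos : ∀ {i : Coord n} {γ : Coord n →₀ ℕ}, γ ≠ Finsupp.single i 1 →
        coeff γ (X i : HolSeries n) = 0 := by
      intro i γ hγ
      rw [coeff_X, if_neg hγ]
    rw [hEc, Finset.sum_eq_zero, sub_zero]
    · have hcase : ∀ γ γ' : Coord n →₀ ℕ, Finsupp.weight (coordWeight n) γ +
          Finsupp.weight (coordWeight n) γ' = m + 2 → γ = Finsupp.single (Sum.inr ()) 1 →
          coeff γ' q = coeff γ' (X (Sum.inr ()) : HolSeries n) *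
          starRingEnd ℂ (coeff (Finsupp.single (Sum.inr ()) 1) q) := by
        intro γ γ' hγ hγw
        apply hQ
        rw [hγw, hsw] at hγ
        omega
      by_cases hα : α = Finsupp.single (Sum.inr ()) 1
      · have h1 := hcase α β hαβ hα
        by_cases hβ : β = Finsupp.single (Sum.inr ()) 1
        · have h2 := hcase β α (by omega) hβ
          subst hα hβ
          rw [coeff_index_single_self_X, one_mul] at h2
          rw [coeff_index_single_self_X, ← h2]
          ring
        · rw [h1, hwpos hβ]
          simp
      · by_cases hβ : β = Finsupp.single (Sum.inr ()) 1
        · have h2 := hcase β α (by omega) hβ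
          rw [h2, hwpos hα]
          simp
        · rw [hwpos hα, hwpos hβ]
          simp
    · intro j _
      have h1 : coeff α (X (Sum.inl j) : HolSeries n) * starRingEnd ℂ (coeff β (p j)) = 0 := by
        by_cases hα : α = Finsupp.single (Sum.inl j) 1
        · rw [hP j β, map_zero, mul_zero]
          rw [hα, hsz] at hαβ
          omega
        · rw [hwpos hα, zero_mul]
      have h2 : coeff α (p j) * coeff β (X (Sum.inl j) : HolSeries n) = 0 := by
        by_cases hβ : β = Finsupp.single (Sum.inl j) 1
        · rw [hP j α, zero_mul]
          rw [hβ, hsz] at hαβ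
          omega
        · rw [hwpos hβ, mul_zero]
      -- If `hP` does not reach `α`, then `α` carries the whole weight `m + 2` and `β` has weight
      -- zero.
      have h3 : coeff α (p j) * starRingEnd ℂ (coeff β (p j)) = 0 := by
        by_cases hα : Finsupp.weight (coordWeight n) α + 1 ≤ m + 2
        · rw [hP j α hα, zero_mul]
        · have := degree_le_weight β
          rw [hp2 j β (by omega), map_zero, mul_zero]
      rw [h1, h2, h3]
      simp
  -- At weight `m + 2` the part of weight `m` of `V`, multiplied by `-⟨z, z̄⟩`, equals a difference
  -- of squares of rank at most `k₁ + k₂`. The first `k₁` products come from `φ₁`, the others from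
  -- `φ₂`.
  have hVorder : ∀ m : ℕ, m ≤ V.weightedOrder (mixedWeight n) := by
    intro m
    induction m with
    | zero => simp
    | succ m ih =>
      apply nat_le_weightedOrder
      intro d hd
      rcases Nat.lt_succ_iff_lt_or_eq.mp hd with hd | hd
      · exact coeff_eq_zero_of_lt_weightedOrder _ (lt_of_lt_of_le (by exact_mod_cast hd) ih)
      rw [← Finsupp.comapDomain_sumElim_comapDomain d] at hd ⊢
      rw [weight_sumElim] at hd
      refine eq_zero_of_mul_scalarProduct_rank_lt hk (fun j : Fin n => (Sum.inl j : Coord n))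
        Sum.inl_injective (coordWeight n) coordWeight_pos (fun j => by simp [coordWeight])
        (fun j => -sgn ℓ j) (fun j => neg_ne_zero.mpr (sgn_ne_zero ℓ j))
        (fun α β => coeff (α.sumElim β) V) m
        (fun i α => Fin.addCases (fun j => sgn s₁ j * coeff α (φ₁ j))
          (fun j => -sgn s₂ j * coeff α (φ₂ j)) i)
        (fun i β => Fin.addCases (fun j => starRingEnd ℂ (coeff β (φ₁ j)))
          (fun j => starRingEnd ℂ (coeff β (φ₂ j))) i)
        _ (fun α β => rfl) ?_ _ _ hd
      intro α β hαβ
      have h1 := congrArg (coeff (α.sumElim β)) hmain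
      rw [coeff_mul_quadric_of_weight_le ℓ s₁ φ₁ hφ₁ V m ih α β hαβ.le, map_sub, map_add,
        (key m ih).2.2 α β hαβ, zero_add, coeff_hermSq, coeff_hermSq] at h1
      rw [h1, Fin.sum_univ_add, sub_eq_add_neg, ← Finset.sum_neg_distrib]
      simp only [Fin.addCases_left, Fin.addCases_right, neg_mul, mul_assoc]
  have hV0 : V = 0 := by
    rw [← weightedOrder_eq_top_iff (mixedWeight n)]
    exact ENat.eq_top_iff_forall_ge.mpr hVorder
  have hp0 : ∀ j, p j = 0 := by
    intro j
    ext α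
    exact (key _ (hVorder (Finsupp.weight (coordWeight n) α))).1 j α (by omega)
  have hqα : ∀ α, coeff α q = coeff α (X (Sum.inr ()) : HolSeries n) *
      starRingEnd ℂ (coeff (Finsupp.single (Sum.inr ()) 1) q) := fun α =>
    (key _ (hVorder (Finsupp.weight (coordWeight n) α + 1))).2.1 α (by omega)
  have hE0 : E = 0 := by
    apply ext_sumElim
    intro α β
    rw [map_zero]
    by_cases h2 : 2 ≤ Finsupp.weight (coordWeight n) α + Finsupp.weight (coordWeight n) β
    · exact (key _ (hVorder (Finsupp.weight (coordWeight n) α +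
        Finsupp.weight (coordWeight n) β - 2))).2.2 α β (by omega)
    · have hα := degree_le_weight α
      have hβ := degree_le_weight β
      rw [hEc, Finset.sum_eq_zero, hqα α, hqα β]
      · have hz : ∀ γ : Coord n →₀ ℕ, Finsupp.weight (coordWeight n) γ < 2 →
            coeff γ (X (Sum.inr ()) : HolSeries n) = 0 := by
          intro γ hγ
          rw [coeff_X, if_neg]
          rintro rfl
          simp [Finsupp.weight_single, coordWeight] at hγ
        rw [hz α (by omega), hz β (by omega)]
        simp
      · intro j _
        simp [hp0]
  refine ⟨rfl, fun j => by simp [hp0], ?_, ?_⟩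
  · have hreal := hqα (Finsupp.single (Sum.inr ()) 1)
    rw [coeff_index_single_self_X, one_mul] at hreal
    obtain ⟨r, hr⟩ := Complex.conj_eq_iff_real.mp hreal.symm
    refine ⟨r, ?_⟩
    congr 1
    ext α
    rw [hqα, coeff_C_mul, hr, Complex.conj_ofReal, mul_comm]
  · rw [hV0, hE0, zero_mul, zero_add] at hmain
    exact (sub_eq_zero.mp hmain.symm)

end Rigidity

end FormalCR

namespace FormalCR

open MvPowerSeries

/-! ### Formal inverse functions -/

section FormalInverse

variable {σ τ : Type*}

theorem le_order_add {f g : MvPowerSeries σ ℂ} {m : ℕ∞} (hf : m ≤ f.order) (hg : m ≤ g.order) :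
    m ≤ (f + g).order := le_trans (le_min hf hg) min_order_le_add

theorem prod_single_add (a : σ → MvPowerSeries τ ℂ) (i : σ) (d : σ →₀ ℕ) :
    ((Finsupp.single i 1 + d).prod fun s e => a s ^ e) = a i * d.prod fun s e => a s ^ e := by
  classical
  rw [Finsupp.prod_add_index' (by simp) (by simp [pow_add]), Finsupp.prod_single_index (by simp),
    pow_one]

theorem one_le_order_prod_pow {a : σ → MvPowerSeries τ ℂ} (ha : ∀ i, 1 ≤ (a i).order)
    {d : σ →₀ ℕ} (hd : d.degree ≠ 0) : 1 ≤ (d.prod fun s e => a s ^ e).order := by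
  obtain ⟨m, hm⟩ := Nat.exists_eq_succ_of_ne_zero hd
  obtain ⟨i, d', rfl, -⟩ := exists_eq_single_add hm
  rw [prod_single_add]
  exact le_trans (le_add_right (ha i)) le_order_mul

/-- Telescoping: `a a' - b b' = (a - b) a' + b (a' - b')`. From degree two on, each difference comes
with a further factor without constant term, which gains one order. -/
theorem le_order_prod_pow_sub {a b : σ → MvPowerSeries τ ℂ} (ha : ∀ i, 1 ≤ (a i).order)
    (hb : ∀ i, 1 ≤ (b i).order) {m : ℕ∞} (hab : ∀ i, m ≤ (a i - b i).order) (d : σ →₀ ℕ) :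
    m ≤ ((d.prod fun s e => a s ^ e) - d.prod fun s e => b s ^ e).order ∧
      (2 ≤ d.degree →
        m + 1 ≤ ((d.prod fun s e => a s ^ e) - d.prod fun s e => b s ^ e).order) := by
  obtain ⟨t, ht⟩ : ∃ t, d.degree = t := ⟨_, rfl⟩
  induction t generalizing d with
  | zero =>
    rw [Finsupp.degree_eq_zero_iff] at ht
    subst ht
    simp
  | succ t ih =>
    obtain ⟨i, d', rfl, hd'⟩ := exists_eq_single_add ht
    have h1 : ((Finsupp.single i 1 + d').prod fun s e => a s ^ e) -
        ((Finsupp.single i 1 + d').prod fun s e => b s ^ e) =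
        (a i - b i) * (d'.prod fun s e => a s ^ e) +
          b i * ((d'.prod fun s e => a s ^ e) - d'.prod fun s e => b s ^ e) := by
      rw [prod_single_add, prod_single_add]
      ring
    rw [h1]
    refine ⟨le_order_add (le_trans (le_add_right (hab i)) le_order_mul)
      (le_trans (le_add_left (ih d' hd').1) le_order_mul), fun h2 => le_order_add
      (le_trans (add_le_add (hab i) (one_le_order_prod_pow ha ?_)) le_order_mul) ?_⟩
    · omega
    · rw [add_comm]
      exact le_trans (add_le_add (hb i) (ih d' hd').1) le_order_mul

/-- Substitution into a series without terms of degree less than two is a contraction in the adic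
topology. This drives the iteration for the inverse map. -/
theorem le_order_subst_sub_subst [Finite σ] {a b : σ → MvPowerSeries τ ℂ}
    (ha : ∀ i, constantCoeff (a i) = 0) (hb : ∀ i, constantCoeff (b i) = 0) {m : ℕ∞}
    (hab : ∀ i, m ≤ (a i - b i).order) {f : MvPowerSeries σ ℂ} (hf : 2 ≤ f.order) :
    m + 1 ≤ (subst a f - subst b f).order := by
  apply le_order
  intro e he
  rw [map_sub, coeff_subst (hasSubst_of_constantCoeff_zero ha),
    coeff_subst (hasSubst_of_constantCoeff_zero hb), sub_eq_zero]
  apply finsum_congr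
  intro d
  by_cases hd : d.degree < 2
  · rw [coeff_of_lt_order (lt_of_lt_of_le (by exact_mod_cast hd) hf), zero_smul, zero_smul]
  · congr 1
    rw [← sub_eq_zero, ← map_sub]
    apply coeff_of_lt_order
    exact lt_of_lt_of_le he ((le_order_prod_pow_sub
      (fun i => one_le_order_iff_constCoeff_eq_zero.mpr (ha i))
      (fun i => one_le_order_iff_constCoeff_eq_zero.mpr (hb i)) hab d).2 (by omega))

/-- The formal inverse function theorem, for maps tangent to the identity. -/
theorem exists_subst_eq_X [Finite σ] (G : σ → MvPowerSeries σ ℂ)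
    (hG : ∀ i, 2 ≤ (G i - X i).order) : ∃ Ψ : σ → MvPowerSeries σ ℂ,
      (∀ i, 2 ≤ (Ψ i - X i).order) ∧ ∀ i, subst Ψ (G i) = X i := by
  have hX1 : ∀ i : σ, 1 ≤ (X i : MvPowerSeries σ ℂ).order := fun i =>
    one_le_order_iff_constCoeff_eq_zero.mpr (constantCoeff_X i)
  have hsub2 : ∀ (a : σ → MvPowerSeries σ ℂ), (∀ i, constantCoeff (a i) = 0) →
      ∀ f : MvPowerSeries σ ℂ, 2 ≤ f.order → 2 ≤ (subst a f).order := by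
    intro a ha f hf
    refine le_trans ?_ (le_order_subst (hasSubst_of_constantCoeff_zero ha) f)
    have h2 : (1 : ℕ∞) ≤ ⨅ i, (a i).order := le_iInf fun i =>
      one_le_order_iff_constCoeff_eq_zero.mpr (ha i)
    refine le_trans ?_ (mul_le_mul' h2 hf)
    simp
  have hc : ∀ f : MvPowerSeries σ ℂ, ∀ i, 2 ≤ (f - X i).order → constantCoeff f = 0 := by
    intro f i hf
    rw [← one_le_order_iff_constCoeff_eq_zero]
    have : f = (f - X i) + X i := by ring
    rw [this]
    exact le_order_add (le_trans (by norm_num) hf) (hX1 i)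
  -- Successive approximation for the fixed point equation `Ψ = X - (G - X) ∘ Ψ`, which is
  -- equivalent to `G ∘ Ψ = X`.
  obtain ⟨ψ, hψ0, hψsucc⟩ : ∃ ψ : ℕ → σ → MvPowerSeries σ ℂ, (∀ i, ψ 0 i = X i) ∧
      ∀ t i, ψ (t + 1) i = X i - subst (ψ t) (G i - X i) :=
    ⟨fun t => Nat.rec (fun i => X i) (fun _ a i => X i - subst a (G i - X i)) t,
      fun _ => rfl, fun _ _ => rfl⟩
  have hψ2 : ∀ t i, 2 ≤ (ψ t i - X i).order := by
    intro t
    induction t with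
    | zero =>
      intro i
      rw [hψ0, sub_self, order_zero]
      exact le_top
    | succ t ih =>
      intro i
      have : ψ (t + 1) i - X i = -subst (ψ t) (G i - X i) := by rw [hψsucc]; ring
      rw [this, order_neg]
      exact hsub2 _ (fun j => hc _ j (ih j)) _ (hG i)
  have hψc : ∀ t i, constantCoeff (ψ t i) = 0 := fun t i => hc _ i (hψ2 t i)
  have hstep : ∀ t : ℕ, ∀ i, (t : ℕ∞) + 2 ≤ (ψ (t + 1) i - ψ t i).order := by
    intro t
    induction t with
    | zero =>
      intro i
      rw [hψ0]
      simpa using hψ2 1 i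
    | succ t ih =>
      intro i
      have : ψ (t + 2) i - ψ (t + 1) i =
          -(subst (ψ (t + 1)) (G i - X i) - subst (ψ t) (G i - X i)) := by
        rw [hψsucc (t + 1), hψsucc t]
        ring
      rw [this, order_neg]
      refine le_trans (le_of_eq ?_) (le_order_subst_sub_subst (hψc _) (hψc _) ih (hG i))
      push_cast
      ring
  have hstab : ∀ (d : σ →₀ ℕ) i (s : ℕ),
      coeff d (ψ (d.degree + s) i) = coeff d (ψ d.degree i) := by
    intro d i s
    induction s with
    | zero => rfl
    | succ s ih =>
      rw [← ih, ← sub_eq_zero, ← map_sub]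
      apply coeff_of_lt_order
      refine lt_of_lt_of_le ?_ (hstep (d.degree + s) i)
      have : d.degree < d.degree + s + 2 := by omega
      exact_mod_cast this
  -- Steps from `ψ t` onwards alter only terms of degree at least `t + 2`, so the coefficient at `d`
  -- is final from the step `d.degree` on.
  obtain ⟨Ψ, hΨ⟩ : ∃ Ψ : σ → MvPowerSeries σ ℂ, ∀ i d, coeff d (Ψ i) = coeff d (ψ d.degree i) :=
    ⟨fun i d => coeff d (ψ d.degree i), fun _ _ => rfl⟩
  have hclose : ∀ t i, ((t + 1 : ℕ) : ℕ∞) ≤ (Ψ i - ψ t i).order := by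
    intro t i
    apply nat_le_order
    intro d hd
    obtain ⟨s, rfl⟩ := Nat.exists_eq_add_of_le (Nat.lt_succ_iff.mp hd)
    rw [map_sub, hΨ, hstab, sub_self]
  have hΨ2 : ∀ i, 2 ≤ (Ψ i - X i).order := by
    intro i
    have : Ψ i - X i = (Ψ i - ψ 1 i) + (ψ 1 i - X i) := by ring
    rw [this]
    exact le_order_add (hclose 1 i) (hψ2 1 i)
  have hΨc : ∀ i, constantCoeff (Ψ i) = 0 := fun i => hc _ i (hΨ2 i)
  refine ⟨Ψ, hΨ2, fun i => ?_⟩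
  have hs : HasSubst Ψ := hasSubst_of_constantCoeff_zero hΨc
  have h1 : subst Ψ (G i) = Ψ i + subst Ψ (G i - X i) := by
    rw [subst_sub hs, subst_X hs]
    ring
  rw [h1, ← sub_eq_zero]
  have h2 : ∀ t : ℕ, (t : ℕ∞) ≤ (Ψ i + subst Ψ (G i - X i) - X i).order := by
    intro t
    have h3 : Ψ i + subst Ψ (G i - X i) - X i = (Ψ i - ψ (t + 1) i) +
        (subst Ψ (G i - X i) - subst (ψ t) (G i - X i)) := by
      rw [hψsucc]
      ring
    rw [h3]
    refine le_order_add (le_trans ?_ (hclose (t + 1) i))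
      (le_trans ?_ (le_order_subst_sub_subst hΨc (hψc t) (hclose t) (hG i)))
    · exact_mod_cast (by omega : t ≤ t + 1 + 1)
    · exact_mod_cast (by omega : t ≤ t + 1 + 1)
  rw [← order_eq_top_iff]
  exact ENat.eq_top_iff_forall_ge.mpr h2

end FormalInverse

end FormalCR

namespace FormalCR

/-! ### Diagonal Hermitian forms and orthogonal families -/

section HermitianForms

variable {ι κ : Type*} [Fintype ι] [Fintype κ]

/-- The diagonal Hermitian form `∑ s_m x_m ȳ_m`. -/
noncomputable def diagHerm (s : ι → ℝ) (x y : ι → ℂ) : ℂ :=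
  ∑ m, (s m : ℂ) * (x m * starRingEnd ℂ (y m))

variable (s : ι → ℝ)

theorem diagHerm_add_left (x x' y : ι → ℂ) :
    diagHerm s (x + x') y = diagHerm s x y + diagHerm s x' y := by
  simp only [diagHerm, ← Finset.sum_add_distrib, Pi.add_apply]
  exact Finset.sum_congr rfl fun m _ => by ring

theorem diagHerm_smul_left (c : ℂ) (x y : ι → ℂ) :
    diagHerm s (c • x) y = c * diagHerm s x y := by
  simp only [diagHerm, Finset.mul_sum, Pi.smul_apply, smul_eq_mul]
  exact Finset.sum_congr rfl fun m _ => by ring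

theorem conj_diagHerm (x y : ι → ℂ) : starRingEnd ℂ (diagHerm s x y) = diagHerm s y x := by
  simp only [diagHerm, map_sum, map_mul, Complex.conj_ofReal, Complex.conj_conj]
  exact Finset.sum_congr rfl fun m _ => by ring

theorem diagHerm_add_right (x y y' : ι → ℂ) :
    diagHerm s x (y + y') = diagHerm s x y + diagHerm s x y' := by
  rw [← conj_diagHerm, diagHerm_add_left, map_add, conj_diagHerm, conj_diagHerm]

theorem diagHerm_smul_right (c : ℂ) (x y : ι → ℂ) :
    diagHerm s x (c • y) = starRingEnd ℂ c * diagHerm s x y := by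
  rw [← conj_diagHerm, diagHerm_smul_left, map_mul, conj_diagHerm]

theorem diagHerm_sum_left {α : Type*} (t : Finset α) (x : α → ι → ℂ) (y : ι → ℂ) :
    diagHerm s (∑ a ∈ t, x a) y = ∑ a ∈ t, diagHerm s (x a) y := by
  simp only [diagHerm, Finset.sum_apply, Finset.sum_mul, Finset.mul_sum]
  exact Finset.sum_comm

theorem diagHerm_sum_right {α : Type*} (t : Finset α) (x : ι → ℂ) (y : α → ι → ℂ) :
    diagHerm s x (∑ a ∈ t, y a) = ∑ a ∈ t, diagHerm s x (y a) := by
  rw [← conj_diagHerm, diagHerm_sum_left, map_sum]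
  simp only [conj_diagHerm]

theorem diagHerm_self_re (x : ι → ℂ) :
    (diagHerm s x x).re = ∑ m, s m * Complex.normSq (x m) := by
  simp only [diagHerm, Complex.re_sum, Complex.mul_conj, ← Complex.ofReal_mul, Complex.ofReal_re]

theorem diagHerm_self (x : ι → ℂ) : diagHerm s x x = ((diagHerm s x x).re : ℂ) :=
  (Complex.conj_eq_iff_re.mp (conj_diagHerm s x x)).symm

/-- An orthogonal family cannot have more negative norms than the form has negative squares. -/
theorem card_neg_le_of_orthogonal [DecidableEq κ] (t : κ → ℝ) (v : κ → ι → ℂ)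
    (hv : ∀ a b, diagHerm s (v a) (v b) = if a = b then (t a : ℂ) else 0) :
    Fintype.card {a // t a < 0} ≤ Fintype.card {m // s m < 0} := by
  by_contra hcon
  push Not at hcon
  -- With too many negative vectors, some nonzero combination has vanishing coordinates in all
  -- negative directions. Its norm is then nonnegative by the form of `s`, and negative by
  -- orthogonality.
  let L : ({a // t a < 0} → ℂ) →ₗ[ℂ] ({m // s m < 0} → ℂ) :=
    LinearMap.pi fun m => ∑ a, v a.1 m.1 • LinearMap.proj a
  obtain ⟨c, hc, hc0⟩ := Submodule.exists_mem_ne_zero_of_ne_bot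
    (LinearMap.ker_ne_bot_of_finrank_lt (f := L) (by simpa using hcon))
  set x : ι → ℂ := ∑ a : {a // t a < 0}, c a • v a.1 with hx
  have hxm : ∀ m, s m < 0 → x m = 0 := by
    intro m hm
    have := congrFun (LinearMap.mem_ker.mp hc) ⟨m, hm⟩
    simpa [L, hx, mul_comm] using this
  have h1 : 0 ≤ (diagHerm s x x).re := by
    rw [diagHerm_self_re]
    apply Finset.sum_nonneg
    intro m _
    by_cases hm : s m < 0
    · simp [hxm m hm]
    · exact mul_nonneg (not_lt.mp hm) (Complex.normSq_nonneg _)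
  have h2 : diagHerm s x x = ((∑ a : {a // t a < 0}, t a.1 * Complex.normSq (c a) : ℝ) : ℂ) := by
    rw [hx, diagHerm_sum_left, Complex.ofReal_sum]
    apply Finset.sum_congr rfl
    intro a _
    rw [diagHerm_sum_right, Finset.sum_eq_single a]
    · rw [diagHerm_smul_left, diagHerm_smul_right, hv, if_pos rfl, Complex.ofReal_mul,
        ← Complex.mul_conj]
      ring
    · intro b _ hb
      rw [diagHerm_smul_left, diagHerm_smul_right, hv, if_neg fun h => hb (Subtype.ext h).symm]
      simp
    · simp
  obtain ⟨a₀, ha₀⟩ := Function.ne_iff.mp hc0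
  have h3 : ∑ a : {a // t a < 0}, t a.1 * Complex.normSq (c a) < 0 := by
    apply Finset.sum_neg'
    · intro a _
      exact mul_nonpos_of_nonpos_of_nonneg a.2.le (Complex.normSq_nonneg _)
    · exact ⟨a₀, Finset.mem_univ _, mul_neg_of_neg_of_pos a₀.2 (Complex.normSq_pos.mpr ha₀)⟩
  rw [h2, Complex.ofReal_re] at h1
  exact absurd h3 (not_lt.mpr h1)

/-- The orthogonal complement of the family is nonzero by dimension and nondegenerate, because the
family and the form are. So it contains a vector of nonzero norm, which can be rescaled; only the
sign `ε` of the norm cannot be prescribed. -/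
theorem exists_orthogonal_of_card_lt [DecidableEq κ] (hs : ∀ m, s m ≠ 0) (t : κ → ℝ)
    (ht : ∀ a, t a ≠ 0) (v : κ → ι → ℂ)
    (hv : ∀ a b, diagHerm s (v a) (v b) = if a = b then (t a : ℂ) else 0)
    (hcard : Fintype.card κ < Fintype.card ι) {u : ℝ} (hu : 0 < u) :
    ∃ (x : ι → ℂ) (ε : ℝ), (ε = 1 ∨ ε = -1) ∧ (∀ a, diagHerm s x (v a) = 0) ∧
      diagHerm s x x = ((u * ε : ℝ) : ℂ) := by
  classical
  suffices h : ∃ x : ι → ℂ, (∀ a, diagHerm s x (v a) = 0) ∧ diagHerm s x x ≠ 0 by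
    obtain ⟨x, hx, hxx⟩ := h
    set r := (diagHerm s x x).re with hr
    have hrx : diagHerm s x x = (r : ℂ) := diagHerm_self s x
    have hr0 : r ≠ 0 := by
      intro h
      rw [hrx, h] at hxx
      simp at hxx
    refine ⟨((Real.sqrt (u / |r|) : ℝ) : ℂ) • x, r / |r|, ?_, ?_, ?_⟩
    · rcases lt_or_gt_of_ne hr0 with h | h
      · right
        rw [abs_of_neg h, div_neg, div_self hr0]
      · left
        rw [abs_of_pos h, div_self hr0]
    · intro a
      rw [diagHerm_smul_left, hx, mul_zero]
    · rw [diagHerm_smul_left, diagHerm_smul_right, hrx, Complex.conj_ofReal, ← mul_assoc,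
        ← Complex.ofReal_mul, ← Complex.ofReal_mul, Real.mul_self_sqrt (by positivity)]
      congr 1
      ring
  by_contra hcon
  push Not at hcon
  let L : (ι → ℂ) →ₗ[ℂ] (κ → ℂ) :=
    LinearMap.pi fun a => ∑ m, ((s m : ℂ) * starRingEnd ℂ (v a m)) • LinearMap.proj m
  obtain ⟨x, hx, hx0⟩ := Submodule.exists_mem_ne_zero_of_ne_bot
    (LinearMap.ker_ne_bot_of_finrank_lt (f := L) (by simpa using hcard))
  have hxv : ∀ a, diagHerm s x (v a) = 0 := by
    intro a
    have h0 : L x a = 0 := congrFun (LinearMap.mem_ker.mp hx) a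
    rw [← h0]
    simp only [diagHerm, L, LinearMap.pi_apply, LinearMap.sum_apply, LinearMap.smul_apply,
      LinearMap.proj_apply, smul_eq_mul]
    exact Finset.sum_congr rfl fun m _ => by ring
  -- Polarization: the norms of `x + y` and `x + i y` kill the real and the imaginary part of the
  -- product.
  have hpol : ∀ y : ι → ℂ, (∀ a, diagHerm s y (v a) = 0) → diagHerm s x y = 0 := by
    intro y hy
    have h1 := hcon (x + y) fun a => by rw [diagHerm_add_left, hxv, hy, add_zero]
    have h2 := hcon (x + Complex.I • y) fun a => by
      rw [diagHerm_add_left, diagHerm_smul_left, hxv, hy, mul_zero, add_zero]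
    rw [diagHerm_add_left, diagHerm_add_right, diagHerm_add_right, hcon x hxv, hcon y hy,
      ← conj_diagHerm s x y] at h1
    rw [diagHerm_add_left, diagHerm_add_right, diagHerm_add_right, diagHerm_smul_left,
      diagHerm_smul_left, diagHerm_smul_right, diagHerm_smul_right, hcon x hxv, hcon y hy,
      ← conj_diagHerm s x y, Complex.conj_I] at h2
    have h3 : starRingEnd ℂ (diagHerm s x y) = -diagHerm s x y := by linear_combination h1
    rw [h3] at h2
    have h4 : (2 * Complex.I) * diagHerm s x y = 0 := by linear_combination -h2
    simpa using h4
  -- Subtracting from `y` its projection to the span of the family reduces to `hpol`, as `x` is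
  -- orthogonal to that span.
  have hall : ∀ y : ι → ℂ, diagHerm s x y = 0 := by
    intro y
    have h1 := hpol (y + ∑ a, (-(diagHerm s y (v a) / t a)) • v a) ?_
    · rw [diagHerm_add_right, diagHerm_sum_right] at h1
      simpa only [diagHerm_smul_right, hxv, mul_zero, Finset.sum_const_zero, add_zero] using h1
    · intro b
      rw [diagHerm_add_left, diagHerm_sum_left, Finset.sum_eq_single b]
      · rw [diagHerm_smul_left, hv, if_pos rfl]
        have : (t b : ℂ) ≠ 0 := by exact_mod_cast ht b
        field_simp
        ring
      · intro a _ hab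
        rw [diagHerm_smul_left, hv, if_neg hab, mul_zero]
      · simp
  apply hx0
  funext m
  have h1 := hall (Pi.single m 1)
  rw [diagHerm, Finset.sum_eq_single m] at h1
  · have : (s m : ℂ) ≠ 0 := by exact_mod_cast hs m
    simpa [this] using h1
  · intro b _ hb
    simp [Pi.single_eq_of_ne hb]
  · simp

theorem exists_orthogonal_extension [DecidableEq κ] (hs : ∀ m, s m ≠ 0) (t : κ → ℝ)
    (ht : ∀ a, t a ≠ 0) (v : κ → ι → ℂ)
    (hv : ∀ a b, diagHerm s (v a) (v b) = if a = b then (t a : ℂ) else 0)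
    {u : ℝ} (hu : 0 < u) (k : ℕ) (hcard : Fintype.card κ + k ≤ Fintype.card ι) :
    ∃ (W : Fin k → ι → ℂ) (ε : Fin k → ℝ), (∀ i, ε i = 1 ∨ ε i = -1) ∧
      ∀ a b : κ ⊕ Fin k, diagHerm s (Sum.elim v W a) (Sum.elim v W b) =
        if a = b then ((Sum.elim t (fun i => u * ε i) a : ℝ) : ℂ) else 0 := by
  induction k with
  | zero =>
    refine ⟨Fin.elim0, Fin.elim0, fun i => i.elim0, ?_⟩
    rintro (a | a) (b | b)
    · simpa using hv a b
    · exact b.elim0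
    · exact a.elim0
    · exact a.elim0
  | succ k ih =>
    obtain ⟨W, ε, hε, hW⟩ := ih (by omega)
    obtain ⟨x, η, hη, hx, hxx⟩ := exists_orthogonal_of_card_lt s hs
      (Sum.elim t (fun i => u * ε i)) (by
        rintro (a | i)
        · exact ht a
        · rcases hε i with h | h <;> simp [h, hu.ne'])
      (Sum.elim v W) hW (by simpa using (by omega : Fintype.card κ + k < Fintype.card ι)) hu
    have hx' : ∀ a, diagHerm s (Sum.elim v W a) x = 0 := fun a => by
      rw [← conj_diagHerm, hx, map_zero]
    refine ⟨Fin.snoc W x, Fin.snoc ε η, ?_, ?_⟩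
    · intro i
      refine Fin.lastCases ?_ (fun i => ?_) i
      · simpa using hη
      · simpa using hε i
    · rintro (a | i) (b | j)
      · simpa using hv a b
      · refine Fin.lastCases ?_ (fun j => ?_) j
        · simpa using hx' (Sum.inl a)
        · simpa using hW (Sum.inl a) (Sum.inr j)
      · refine Fin.lastCases ?_ (fun i => ?_) i
        · simpa using hx (Sum.inl b)
        · simpa using hW (Sum.inr i) (Sum.inl b)
      · refine Fin.lastCases ?_ (fun i => ?_) i <;> refine Fin.lastCases ?_ (fun j => ?_) j
        · simpa using hxx
        · simpa [(Fin.castSucc_lt_last j).ne'] using hx (Sum.inr j)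
        · simpa [(Fin.castSucc_lt_last i).ne] using hx' (Sum.inr i)
        · simpa using hW (Sum.inr i) (Sum.inr j)

theorem exists_equiv_of_card_neg_eq (f : κ → ℝ) (g : ι → ℝ) (hf : ∀ a, f a = 1 ∨ f a = -1)
    (hg : ∀ a, g a = 1 ∨ g a = -1) (hcard : Fintype.card κ = Fintype.card ι)
    (hneg : Fintype.card {a // f a < 0} = Fintype.card {a // g a < 0}) :
    ∃ e : κ ≃ ι, ∀ a, g (e a) = f a := by
  classical
  let e₁ : {a // f a < 0} ≃ {a // g a < 0} := Fintype.equivOfCardEq hneg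
  let e₂ : {a // ¬ f a < 0} ≃ {a // ¬ g a < 0} := Fintype.equivOfCardEq (by
    rw [Fintype.card_subtype_compl, Fintype.card_subtype_compl, hcard, hneg])
  refine ⟨(Equiv.sumCompl _).symm.trans ((Equiv.sumCongr e₁ e₂).trans (Equiv.sumCompl _)), ?_⟩
  intro a
  by_cases ha : f a < 0
  · have h1 := (e₁ ⟨a, ha⟩).2
    have h2 : f a = -1 := (hf a).resolve_left fun h => by rw [h] at ha; norm_num at ha
    rw [Equiv.trans_apply, Equiv.trans_apply, Equiv.sumCompl_symm_apply_of_pos (p := fun a => f a < 0) ha]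
    simp only [Equiv.sumCongr_apply, Sum.map_inl, Equiv.sumCompl_apply_inl]
    rw [h2]
    exact (hg _).resolve_left fun h => by rw [h] at h1; norm_num at h1
  · have h1 := (e₂ ⟨a, ha⟩).2
    have h2 : f a = 1 := (hf a).resolve_right fun h => by rw [h] at ha; norm_num at ha
    rw [Equiv.trans_apply, Equiv.trans_apply, Equiv.sumCompl_symm_apply_of_neg (p := fun a => f a < 0) ha]
    simp only [Equiv.sumCongr_apply, Sum.map_inr, Equiv.sumCompl_apply_inr]
    rw [h2]
    exact (hg _).resolve_right fun h => by rw [h] at h1; norm_num at h1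

end HermitianForms

end FormalCR

namespace FormalCR

/-! ### Signatures and the Witt extension -/

section Signature

/-- The signs `sgn ℓ`, as real numbers. -/
noncomputable def realSgn (ℓ : ℕ) {m : ℕ} (j : Fin m) : ℝ := if (j : ℕ) < ℓ then -1 else 1

theorem ofReal_realSgn (ℓ : ℕ) {m : ℕ} (j : Fin m) : (realSgn ℓ j : ℂ) = sgn ℓ j := by
  unfold realSgn sgn
  split_ifs <;> simp

theorem realSgn_eq (ℓ : ℕ) {m : ℕ} (j : Fin m) : realSgn ℓ j = 1 ∨ realSgn ℓ j = -1 := by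
  unfold realSgn
  split_ifs <;> simp

theorem realSgn_ne_zero (ℓ : ℕ) {m : ℕ} (j : Fin m) : realSgn ℓ j ≠ 0 := by
  rcases realSgn_eq ℓ j with h | h <;> simp [h]

theorem realSgn_neg_iff (ℓ : ℕ) {m : ℕ} (j : Fin m) : realSgn ℓ j < 0 ↔ (j : ℕ) < ℓ := by
  unfold realSgn
  split_ifs with h <;> simp [h]

theorem card_realSgn_neg (ℓ m : ℕ) : Fintype.card {j : Fin m // realSgn ℓ j < 0} = min m ℓ := by
  rw [Fintype.card_subtype, ← Fin.card_filter_val_lt]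
  simp only [realSgn_neg_iff]

theorem card_realSgn_pos (ℓ m : ℕ) :
    Fintype.card {j : Fin m // 0 < realSgn ℓ j} = m - min m ℓ := by
  have h : ∀ j : Fin m, 0 < realSgn ℓ j ↔ ¬ realSgn ℓ j < 0 := fun j =>
    ⟨fun h => not_lt.mpr h.le, fun h => lt_of_le_of_ne (not_lt.mp h) (realSgn_ne_zero ℓ j).symm⟩
  rw [← card_realSgn_neg ℓ m, Fintype.card_congr (Equiv.subtypeEquivRight h),
    Fintype.card_subtype_compl, Fintype.card_fin]

variable {n k : ℕ}

/-- The sign of the scaling factor of an isometric embedding is determined by the signatures. -/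
theorem pos_of_orthogonal_family {ℓ ℓ' : ℕ} (hℓ : ℓ' + ℓ < n) {u : ℝ} (hu : u ≠ 0)
    (v : Fin n → Fin (n + k) → ℂ)
    (hv : ∀ a b, diagHerm (realSgn ℓ') (v a) (v b) =
      if a = b then ((u * realSgn ℓ a : ℝ) : ℂ) else 0) : 0 < u := by
  by_contra hcon
  have hu' : u < 0 := lt_of_le_of_ne (not_lt.mp hcon) hu
  -- A negative factor would turn the `n - ℓ` positive directions into negative ones, but the target
  -- has only `ℓ' < n - ℓ` of these.
  have h1 := card_neg_le_of_orthogonal (realSgn ℓ') (fun a => u * realSgn ℓ a) v hv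
  have h2 : ∀ a : Fin n, u * realSgn ℓ a < 0 ↔ 0 < realSgn ℓ a := fun a => by
    constructor
    · intro h
      by_contra h'
      exact absurd h (not_lt.mpr (mul_nonneg_of_nonpos_of_nonpos hu'.le (not_lt.mp h')))
    · exact fun h => mul_neg_of_neg_of_pos hu' h
  rw [Fintype.card_congr (Equiv.subtypeEquivRight h2), card_realSgn_pos, card_realSgn_neg] at h1
  omega

/-- Witt extension of an isometric embedding (up to a factor `u`), adapted to a renumbering of the
coordinates. -/
theorem exists_isometric_extension {ℓ ℓ' : ℕ} (hℓℓ' : ℓ ≤ ℓ') (hℓ : ℓ' + ℓ < n) {u : ℝ}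
    (hu : 0 < u) (v : Fin n → Fin (n + k) → ℂ)
    (hv : ∀ a b, diagHerm (realSgn ℓ') (v a) (v b) =
      if a = b then ((u * realSgn ℓ a : ℝ) : ℂ) else 0) :
    ∃ (e : Fin n ⊕ Fin k ≃ Fin (n + k)) (P : Fin n ⊕ Fin k → Fin (n + k) → ℂ),
      IsRenumbering ℓ ℓ' e ∧ (∀ a, P (Sum.inl a) = v a) ∧
      ∀ a b, diagHerm (realSgn ℓ') (P a) (P b) =
        if a = b then (u : ℂ) * sgn ℓ' (e a) else 0 := by
  obtain ⟨W, ε, hε, hW⟩ := exists_orthogonal_extension (realSgn ℓ') (realSgn_ne_zero ℓ')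
    (fun a => u * realSgn ℓ a) (fun a => mul_ne_zero hu.ne' (realSgn_ne_zero ℓ a)) v hv hu k
    (by simp)
  set t : Fin n ⊕ Fin k → ℝ := Sum.elim (fun a => u * realSgn ℓ a) fun i => u * ε i with ht
  have h1 := card_neg_le_of_orthogonal (realSgn ℓ') t _ hW
  -- The same bound for the opposite form gives the reverse inequality. Together they are
  -- Sylvester's law for the full orthogonal family.
  have h2 := card_neg_le_of_orthogonal (fun m => -realSgn ℓ' m) (fun a => -t a) (Sum.elim v W)
    (by
      intro a b
      have h3 : diagHerm (fun m => -realSgn ℓ' m) (Sum.elim v W a) (Sum.elim v W b) =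
          -diagHerm (realSgn ℓ') (Sum.elim v W a) (Sum.elim v W b) := by
        simp [diagHerm]
      rw [h3, hW]
      split_ifs <;> simp)
  have ht0 : ∀ a, t a ≠ 0 := by
    rintro (a | i)
    · exact mul_ne_zero hu.ne' (realSgn_ne_zero ℓ a)
    · rcases hε i with h | h <;> simp [ht, h, hu.ne']
  have h4 : Fintype.card {a // -t a < 0} = n + k - Fintype.card {a // t a < 0} := by
    have : ∀ a, -t a < 0 ↔ ¬ t a < 0 := fun a => by
      rw [neg_lt_zero]
      exact ⟨fun h => not_lt.mpr h.le, fun h => lt_of_le_of_ne (not_lt.mp h) (ht0 a).symm⟩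
    rw [Fintype.card_congr (Equiv.subtypeEquivRight this), Fintype.card_subtype_compl]
    simp
  have h5 : Fintype.card {a : Fin (n + k) // -realSgn ℓ' a < 0} = n + k - min (n + k) ℓ' := by
    rw [← card_realSgn_pos]
    exact Fintype.card_congr (Equiv.subtypeEquivRight fun a => by rw [neg_lt_zero])
  rw [h4, h5] at h2
  rw [card_realSgn_neg] at h1
  have h6 : Fintype.card {a // t a < 0} =
      Fintype.card {a : Fin n // realSgn ℓ a < 0} + Fintype.card {i // ε i < 0} := by
    rw [← Fintype.card_sum]
    refine Fintype.card_congr ((Equiv.subtypeSum).trans (Equiv.sumCongr ?_ ?_))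
    · exact Equiv.subtypeEquivRight fun a => by simp [ht, mul_neg_iff, hu, hu.not_gt]
    · exact Equiv.subtypeEquivRight fun a => by simp [ht, mul_neg_iff, hu, hu.not_gt]
  rw [card_realSgn_neg] at h6
  have hεle : Fintype.card {i // ε i < 0} ≤ k := by
    simpa using Fintype.card_subtype_le fun i => ε i < 0
  -- The count leaves exactly `ℓ' - ℓ` negative signs among the `k` new vectors; in particular `ℓ' -
  -- ℓ ≤ k`. The new vectors are permuted so that the negative ones come first.
  obtain ⟨π, hπ⟩ := exists_equiv_of_card_neg_eq (realSgn (ℓ' - ℓ) : Fin k → ℝ) ε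
    (realSgn_eq _) hε rfl (by rw [card_realSgn_neg]; omega)
  obtain ⟨e, he⟩ := exists_equiv_of_card_neg_eq
    (Sum.elim (realSgn ℓ) (realSgn (ℓ' - ℓ)) : Fin n ⊕ Fin k → ℝ) (realSgn ℓ' : Fin (n + k) → ℝ)
    (by
      rintro (a | a)
      · exact realSgn_eq _ a
      · exact realSgn_eq _ a)
    (realSgn_eq _) (by simp) (by
      have h7 : Fintype.card {a // (Sum.elim (realSgn ℓ) (realSgn (ℓ' - ℓ)) :
          Fin n ⊕ Fin k → ℝ) a < 0} = Fintype.card {a : Fin n // realSgn ℓ a < 0} +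
          Fintype.card {a : Fin k // realSgn (ℓ' - ℓ) a < 0} := by
        rw [← Fintype.card_sum]
        exact Fintype.card_congr ((Equiv.subtypeSum).trans (Equiv.sumCongr
          (Equiv.subtypeEquivRight fun a => Iff.rfl) (Equiv.subtypeEquivRight fun a => Iff.rfl)))
      rw [h7, card_realSgn_neg, card_realSgn_neg, card_realSgn_neg]
      omega)
  refine ⟨e, Sum.elim v (W ∘ π), ⟨fun j => ?_, fun j => ?_⟩, fun a => rfl, ?_⟩
  · rw [← ofReal_realSgn, ← ofReal_realSgn, he]
    rfl
  · rw [← ofReal_realSgn, ← ofReal_realSgn, he]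
    rfl
  · intro a b
    have h7 : ∀ a, Sum.elim v (W ∘ π) a = Sum.elim v W (Sum.map id π a) := by
      rintro (a | a) <;> rfl
    have hinj : Function.Injective (Sum.map (id : Fin n → Fin n) π) :=
      Function.Injective.sumMap Function.injective_id π.injective
    rw [h7, h7, hW, ← ofReal_realSgn, he]
    simp only [hinj.eq_iff]
    split_ifs with hab
    · rw [← Complex.ofReal_mul]
      congr 1
      rcases a with a | a
      · rfl
      · simp [ht, hπ]
    · rfl

end Signature

end FormalCR

namespace FormalCR

open MvPowerSeries

/-! ### Linear fractional maps: convergence and invariance -/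

section LinearFractional

/-- A finite set of exponents lies in a box, over which the sum factors into partial geometric sums,
each at most `2`. -/
theorem summable_half_pow_degree (σ : Type*) [Fintype σ] :
    Summable fun d : σ →₀ ℕ => (1 / 2 : ℝ) ^ d.degree := by
  classical
  refine summable_of_sum_le (c := ∏ _i : σ, (2 : ℝ)) (fun d => by positivity) fun s => ?_
  set M := s.sup fun d => d.degree with hM
  have h1 : ∀ d ∈ s, (⇑d : σ → ℕ) ∈ Fintype.piFinset fun _ : σ => Finset.range (M + 1) := by
    intro d hd
    rw [Fintype.mem_piFinset]
    intro i
    rw [Finset.mem_range, Nat.lt_succ_iff]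
    exact le_trans (Finsupp.le_degree i d) (Finset.le_sup (f := fun d => d.degree) hd)
  calc ∑ d ∈ s, (1 / 2 : ℝ) ^ d.degree
      = ∑ f ∈ s.image (fun d : σ →₀ ℕ => (⇑d : σ → ℕ)), ∏ i, (1 / 2 : ℝ) ^ f i := by
        rw [Finset.sum_image fun a _ b _ h => DFunLike.coe_injective h]
        refine Finset.sum_congr rfl fun d _ => ?_
        rw [Finset.prod_pow_eq_pow_sum, Finsupp.degree_eq_sum]
    _ ≤ ∑ f ∈ Fintype.piFinset fun _ : σ => Finset.range (M + 1), ∏ i, (1 / 2 : ℝ) ^ f i := by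
        apply Finset.sum_le_sum_of_subset_of_nonneg
        · intro f hf
          obtain ⟨d, hd, rfl⟩ := Finset.mem_image.mp hf
          exact h1 d hd
        · intro f _ _
          positivity
    _ = ∏ _i : σ, ∑ j ∈ Finset.range (M + 1), (1 / 2 : ℝ) ^ j := by
        rw [Finset.prod_univ_sum]
    _ ≤ ∏ _i : σ, (2 : ℝ) := by
        apply Finset.prod_le_prod
        · intro i _
          positivity
        · intro i _
          have h2 := summable_geometric_two.sum_le_tsum (Finset.range (M + 1))
            (fun i _ => by positivity)
          rwa [tsum_geometric_two] at h2

variable {m : ℕ}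

theorem isConvergent_of_norm_coeff_le {f : HolSeries m} {K c : ℝ} (hc : 0 < c)
    (h : ∀ d, ‖coeff d f‖ ≤ K * c ^ d.degree) : IsConvergent f := by
  refine ⟨1 / (2 * c), by positivity, ?_⟩
  refine Summable.of_nonneg_of_le (fun d => by positivity) (fun d => ?_)
    ((summable_half_pow_degree (Coord m)).mul_left K)
  calc ‖coeff d f‖ * (1 / (2 * c)) ^ d.degree
      ≤ K * c ^ d.degree * (1 / (2 * c)) ^ d.degree := by
        gcongr
        exact h d
    _ = K * (1 / 2) ^ d.degree := by
        rw [mul_assoc, ← mul_pow]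
        congr 2
        field_simp

/-- The linear form with coefficients `a`. -/
noncomputable def linearForm (a : Coord m → ℂ) : HolSeries m := ∑ i, C (a i) * X i

theorem constantCoeff_linearForm (a : Coord m → ℂ) : constantCoeff (linearForm a) = 0 := by
  simp [linearForm]

theorem coeff_single_linearForm (a : Coord m → ℂ) (j : Coord m) :
    coeff (Finsupp.single j 1) (linearForm a) = a j := by
  classical
  simp only [linearForm, map_sum, coeff_C_mul, coeff_index_single_X]
  simp

theorem norm_coeff_linearForm_mul_le (a : Coord m → ℂ) (g : HolSeries m) (d : Coord m →₀ ℕ) :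
    ‖coeff d (linearForm a * g)‖ ≤ ∑ i, ‖a i‖ * (if Finsupp.single i 1 ≤ d
      then ‖coeff (d - Finsupp.single i 1) g‖ else 0) := by
  classical
  rw [linearForm, Finset.sum_mul, map_sum]
  refine le_trans (norm_sum_le _ _) (le_of_eq ?_)
  refine Finset.sum_congr rfl fun i _ => ?_
  rw [mul_assoc, coeff_C_mul, norm_mul, X, coeff_monomial_mul, one_mul]
  split_ifs <;> simp

theorem degree_sub_single {d : Coord m →₀ ℕ} {i : Coord m} (h : Finsupp.single i 1 ≤ d) :
    (d - Finsupp.single i 1).degree + 1 = d.degree := by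
  conv_rhs => rw [← tsub_add_cancel_of_le h, map_add, Finsupp.degree_single]

/-- Induction on the degree by the recursion `g = 1 - L g` for `g = (1 + L)⁻¹`, with `L` the linear
form. -/
theorem norm_coeff_inv_le (a : Coord m → ℂ) (d : Coord m →₀ ℕ) :
    ‖coeff d (1 + linearForm a)⁻¹‖ ≤ (1 + ∑ i, ‖a i‖) ^ d.degree := by
  classical
  obtain ⟨t, ht⟩ : ∃ t, d.degree = t := ⟨_, rfl⟩
  have hg : (1 + linearForm a)⁻¹ = 1 - linearForm a * (1 + linearForm a)⁻¹ := by
    have := MvPowerSeries.mul_inv_cancel (1 + linearForm a)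
      (by simp [constantCoeff_linearForm])
    linear_combination this
  have hnn : 0 ≤ ∑ i, ‖a i‖ := Finset.sum_nonneg fun i _ => norm_nonneg _
  induction t generalizing d with
  | zero =>
    rw [Finsupp.degree_eq_zero_iff] at ht
    subst ht
    rw [coeff_zero_eq_constantCoeff_apply, constantCoeff_inv]
    simp [constantCoeff_linearForm]
  | succ t ih =>
    have hd : d ≠ 0 := by
      rintro rfl
      simp at ht
    rw [hg, map_sub, coeff_one, if_neg hd, zero_sub, norm_neg]
    refine le_trans (norm_coeff_linearForm_mul_le _ _ _) ?_
    calc _ ≤ ∑ i, ‖a i‖ * (1 + ∑ i, ‖a i‖) ^ t := by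
          refine Finset.sum_le_sum fun i _ => mul_le_mul_of_nonneg_left ?_ (norm_nonneg _)
          split_ifs with h
          · have h1 := degree_sub_single h
            have h2 : (d - Finsupp.single i 1).degree = t := by omega
            have h3 := ih _ h2
            rwa [h2] at h3
          · positivity
      _ = (∑ i, ‖a i‖) * (1 + ∑ i, ‖a i‖) ^ t := by rw [Finset.sum_mul]
      _ ≤ (1 + ∑ i, ‖a i‖) * (1 + ∑ i, ‖a i‖) ^ t := by
          gcongr
          linarith
      _ = _ := by rw [ht, pow_succ']

theorem isConvergent_linearFractional (c a : Coord m → ℂ) :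
    IsConvergent (linearForm c * (1 + linearForm a)⁻¹) := by
  have hnn : 0 ≤ ∑ i, ‖a i‖ := Finset.sum_nonneg fun i _ => norm_nonneg _
  refine isConvergent_of_norm_coeff_le (K := ∑ i, ‖c i‖) (c := 1 + ∑ i, ‖a i‖) (by linarith) ?_
  intro d
  refine le_trans (norm_coeff_linearForm_mul_le _ _ _) ?_
  rw [Finset.sum_mul]
  refine Finset.sum_le_sum fun i _ => mul_le_mul_of_nonneg_left ?_ (norm_nonneg _)
  split_ifs with h
  · refine le_trans (norm_coeff_inv_le a _) (pow_le_pow_right₀ (by linarith) ?_)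
    have := degree_sub_single h
    omega
  · positivity

theorem coeff_single_mul (f g : HolSeries m) (j : Coord m) :
    coeff (Finsupp.single j 1) (f * g) = coeff (Finsupp.single j 1) f * constantCoeff g +
      constantCoeff f * coeff (Finsupp.single j 1) g := by
  classical
  rw [coeff_mul, Finsupp.antidiagonal_single]
  simp [Finset.Nat.antidiagonal_succ, add_comm]

/-- The Hermitian form `Im (g h̄) - ⟨f, f̄⟩` in homogeneous coordinates. -/
noncomputable def homForm {n k : ℕ} (ℓ : ℕ) (h g : HolSeries n) (f : Fin k → HolSeries n) :
    MixedSeries n :=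
  C (1 / (2 * Complex.I)) * (hol g * antihol h - hol h * antihol g) - hermSq ℓ f

/-- Homogeneous coordinates may be rescaled by a common holomorphic factor at the price of its
squared modulus. This clears denominators and later normalizes the factor in the mapping equation.
-/
theorem homForm_mul {n k : ℕ} (ℓ : ℕ) (c h g : HolSeries n) (f : Fin k → HolSeries n) :
    homForm ℓ (c * h) (c * g) (fun j => c * f j) =
      hol c * antihol c * homForm ℓ h g f := by
  simp only [homForm, hermSq, hol_mul, antihol_mul]
  rw [mul_sub (hol c * antihol c), Finset.mul_sum]
  congr 1
  · ring
  · exact Finset.sum_congr rfl fun j _ => by ring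

theorem pullback_homForm {n k p : ℕ} {H : FormalMap p n} (hH : FixesZero H) (ℓ : ℕ)
    (h g : HolSeries n) (f : Fin k → HolSeries n) :
    pullback H (homForm ℓ h g f) =
      homForm ℓ (subst H h) (subst H g) (fun j => subst H (f j)) := by
  unfold homForm
  rw [pullback_sub hH, pullback_mul hH, pullback_sub hH, pullback_mul hH, pullback_mul hH,
    pullback_C, pullback_hol hH, pullback_hol hH, pullback_antihol hH, pullback_antihol hH,
    pullback_hermSq hH]

theorem pullback_quadricSeries_eq_homForm {n p : ℕ} {H : FormalMap p n} (hH : FixesZero H)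
    (ℓ : ℕ) : pullback H (quadricSeries n ℓ) =
      homForm ℓ 1 (H (Sum.inr ())) fun j => H (Sum.inl j) := by
  rw [pullback_quadricSeries hH]
  simp [homForm, hol_one, antihol_one]

/-- A linear fractional map whose homogeneous lift preserves the Hermitian form up to a factor is
an automorphism of the hyperquadric. -/
theorem isLocalAut_linearFractional {ℓ : ℕ} (c : Coord m → Coord m → ℂ) (a : Coord m → ℂ)
    {u : ℂ} (hu : u ≠ 0) (hc : IsUnit (Matrix.of c))
    (hform : C u * homForm ℓ (1 + linearForm a) (linearForm (c (Sum.inr ())))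
      (fun j => linearForm (c (Sum.inl j))) = quadricSeries m ℓ) :
    IsLocalAut (fun i => linearForm (c i) * (1 + linearForm a)⁻¹) (hyperquadric m ℓ) := by
  have h1 : constantCoeff (1 + linearForm a) ≠ 0 := by simp [constantCoeff_linearForm]
  have hfix : FixesZero fun i => linearForm (c i) * (1 + linearForm a)⁻¹ := fun i => by
    simp [constantCoeff_linearForm]
  refine ⟨⟨hfix, ?_⟩, fun i => isConvergent_linearFractional _ _, ?_⟩
  · convert hc using 1
    ext i j
    simp only [jac, Matrix.of_apply, coeff_single_mul, coeff_single_linearForm,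
      constantCoeff_linearForm, constantCoeff_inv]
    simp [constantCoeff_linearForm]
  · have hunit : IsUnit (hol (1 + linearForm a) * antihol (1 + linearForm a) * C u) := by
      rw [isUnit_iff_constantCoeff]
      simp [constantCoeff_hol, constantCoeff_antihol, constantCoeff_linearForm, hu]
    refine ⟨hunit.unit, ?_⟩
    rw [IsUnit.unit_spec]
    change pullback _ (quadricSeries m ℓ) * _ = quadricSeries m ℓ
    rw [pullback_quadricSeries_eq_homForm hfix, ← mul_assoc, mul_comm, mul_comm (homForm _ _ _ _),
      ← homForm_mul, ← hform]
    congr 2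
    · rw [mul_one]
    · rw [mul_left_comm, MvPowerSeries.mul_inv_cancel _ h1, mul_one]
    · funext j
      rw [mul_left_comm, MvPowerSeries.mul_inv_cancel _ h1, mul_one]

end LinearFractional

end FormalCR

namespace FormalCR

open MvPowerSeries

/-! ### The linear part of a transversal embedding -/

section LinearNormalization

variable {n k : ℕ}

theorem sum_antidiagonal_single (i : Coord n) (F : (Coord n →₀ ℕ) → (Coord n →₀ ℕ) → ℂ) :
    ∑ x ∈ Finset.HasAntidiagonal.antidiagonal (Finsupp.single i 1), F x.1 x.2 =
      F (Finsupp.single i 1) 0 + F 0 (Finsupp.single i 1) := by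
  classical
  rw [Finsupp.antidiagonal_single]
  simp [Finset.Nat.antidiagonal_succ, add_comm]

/-- The terms of low order of the equation of a hypersurface. -/
theorem coeff_quadric_sub_of_degree_le {ℓ : ℕ} {A : MixedSeries n} (hA : 3 ≤ A.order)
    (α β : Coord n →₀ ℕ) (h : α.degree + β.degree ≤ 2) :
    coeff (α.sumElim β) (quadricSeries n ℓ - A) = coeff (α.sumElim β) (quadricSeries n ℓ) := by
  rw [map_sub, coeff_of_lt_order (f := A), sub_zero]
  refine lt_of_lt_of_le ?_ hA
  have h1 : (α.sumElim β).degree = α.degree + β.degree := by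
    simp [Finsupp.degree_eq_sum]
  rw [h1]
  exact_mod_cast (by omega : α.degree + β.degree < 3)

/-- The first and second order consequences of a mapping equation between hypersurfaces. -/
theorem linear_part_of_mul_quadric_eq {ℓ ℓ' : ℕ} (H : FormalMap n (n + k)) (hH : FixesZero H)
    (htrans : ∃ j, coeff (Finsupp.single j 1) (H (Sum.inr ())) ≠ 0) (A : MixedSeries n)
    (hA : 3 ≤ A.order) (U : MixedSeries n)
    (hU : U * (quadricSeries n ℓ - A) = pullback H (quadricSeries (n + k) ℓ')) :
    ∃ u : ℝ, u ≠ 0 ∧ constantCoeff U = u ∧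
      (∀ j, coeff (Finsupp.single j 1) (H (Sum.inr ())) = if j = Sum.inr () then (u : ℂ) else 0) ∧
      ∀ a b : Fin n, diagHerm (realSgn ℓ')
          (fun m => coeff (Finsupp.single (Sum.inl a) 1) (H (Sum.inl m)))
          (fun m => coeff (Finsupp.single (Sum.inl b) 1) (H (Sum.inl m))) =
        if a = b then ((u * realSgn ℓ a : ℝ) : ℂ) else 0 := by
  classical
  have hI : (1 / (2 * Complex.I) : ℂ) ≠ 0 := by simp
  rw [pullback_quadricSeries hH] at hU
  have hH0 : ∀ i, coeff 0 (H i) = 0 := hH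
  have hQ := fun (α β : Coord n →₀ ℕ) h => coeff_quadric_sub_of_degree_le (ℓ := ℓ) hA α β h
  have hU0 : coeff ((0 : Coord n →₀ ℕ).sumElim (0 : Coord n →₀ ℕ)) U = constantCoeff U := by
    rw [Finsupp.sumElim_zero_zero, coeff_zero_eq_constantCoeff_apply]
  -- The holomorphic linear terms of the mapping equation determine the linear part of the last
  -- component; the term in `w̄` then shows that the factor is real, and the terms in `z_a z̄_b`
  -- compare the Levi forms.
  have hhol : ∀ j, coeff (Finsupp.single j 1) (H (Sum.inr ())) =
      if j = Sum.inr () then constantCoeff U else 0 := by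
    intro j
    have h1 := congrArg (coeff ((Finsupp.single j 1 : Coord n →₀ ℕ).sumElim 0)) hU
    rw [coeff_sumElim_mul, sum_antidiagonal_single j (fun x y => ∑ z ∈
      Finset.HasAntidiagonal.antidiagonal 0, coeff (x.sumElim z.1) U *
        coeff (y.sumElim z.2) (quadricSeries n ℓ - A))] at h1
    simp only [Finset.HasAntidiagonal.antidiagonal_zero, Finset.sum_singleton] at h1
    rw [hQ _ _ (by simp), hQ _ _ (by simp), hU0, coeff_quadricSeries, coeff_quadricSeries,
      map_sub, coeff_C_mul, map_sub, coeff_hol, coeff_antihol, coeff_hermSq] at h1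
    simp only [if_true, coeff_zero_X, hH0, map_zero, mul_zero, Finset.sum_const_zero, sub_zero,
      ite_self, zero_add, sub_self, coeff_index_single_X] at h1
    apply mul_left_cancel₀ hI
    rw [← h1]
    simp only [eq_comm (a := j)]
    split_ifs <;> ring
  have hreal : starRingEnd ℂ (constantCoeff U) = constantCoeff U := by
    have h1 := congrArg (coeff ((0 : Coord n →₀ ℕ).sumElim (Finsupp.single (Sum.inr ()) 1))) hU
    rw [coeff_sumElim_mul, Finset.sum_comm, sum_antidiagonal_single (Sum.inr ()) (fun x y => ∑ z ∈
      Finset.HasAntidiagonal.antidiagonal (0 : Coord n →₀ ℕ), coeff (z.1.sumElim x) U *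
        coeff (z.2.sumElim y) (quadricSeries n ℓ - A))] at h1
    simp only [Finset.HasAntidiagonal.antidiagonal_zero, Finset.sum_singleton] at h1
    rw [hQ _ _ (by simp), hQ _ _ (by simp), hU0, coeff_quadricSeries, coeff_quadricSeries,
      map_sub, coeff_C_mul, map_sub, coeff_hol, coeff_antihol, coeff_hermSq] at h1
    simp only [if_true, coeff_zero_X, hH0, mul_zero, zero_mul, Finset.sum_const_zero,
      sub_zero, ite_self, zero_add, sub_self, coeff_index_single_X, hhol] at h1
    simp only [zero_sub] at h1
    have h2 : (1 / (2 * Complex.I)) * starRingEnd ℂ (constantCoeff U) =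
        (1 / (2 * Complex.I)) * constantCoeff U := by linear_combination h1
    exact mul_left_cancel₀ hI h2
  obtain ⟨u, hu⟩ := Complex.conj_eq_iff_real.mp hreal
  rw [hu] at hhol
  refine ⟨u, ?_, hu, hhol, ?_⟩
  · rintro rfl
    obtain ⟨j, hj⟩ := htrans
    apply hj
    rw [hhol]
    simp
  · intro a b
    have h1 := congrArg (coeff ((Finsupp.single (Sum.inl a) 1 : Coord n →₀ ℕ).sumElim
      (Finsupp.single (Sum.inl b) 1))) hU
    rw [coeff_sumElim_mul, sum_antidiagonal_single (Sum.inl a) (fun x y => ∑ z ∈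
      Finset.HasAntidiagonal.antidiagonal (Finsupp.single (Sum.inl b) 1),
        coeff (x.sumElim z.1) U * coeff (y.sumElim z.2) (quadricSeries n ℓ - A)),
      sum_antidiagonal_single (Sum.inl b) (fun z z' => coeff
        ((Finsupp.single (Sum.inl a) 1 : Coord n →₀ ℕ).sumElim z) U *
        coeff ((0 : Coord n →₀ ℕ).sumElim z') (quadricSeries n ℓ - A)),
      sum_antidiagonal_single (Sum.inl b) (fun z z' => coeff ((0 : Coord n →₀ ℕ).sumElim z) U *
        coeff ((Finsupp.single (Sum.inl a) 1 : Coord n →₀ ℕ).sumElim z') (quadricSeries n ℓ - A)),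
      hQ _ _ (by simp), hQ _ _ (by simp), hQ _ _ (by simp), hQ _ _ (by simp), hU0, hu,
      coeff_quadricSeries, coeff_quadricSeries, coeff_quadricSeries, coeff_quadricSeries,
      map_sub, coeff_C_mul, map_sub, coeff_hol, coeff_antihol, coeff_hermSq] at h1
    simp only [coeff_zero_X, mul_zero, zero_mul, Finset.sum_const_zero,
      ite_self, zero_add, sub_self, coeff_index_single_X, reduceCtorEq, if_false,
      Finsupp.single_eq_zero, one_ne_zero, add_zero, zero_sub, Sum.inl.injEq] at h1
    have h2 : diagHerm (realSgn ℓ')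
          (fun m => coeff (Finsupp.single (Sum.inl a) 1) (H (Sum.inl m)))
          (fun m => coeff (Finsupp.single (Sum.inl b) 1) (H (Sum.inl m))) =
        ∑ m, sgn ℓ' m * (coeff (Finsupp.single (Sum.inl a) 1) (H (Sum.inl m)) *
          starRingEnd ℂ (coeff (Finsupp.single (Sum.inl b) 1) (H (Sum.inl m)))) := by
      simp only [diagHerm, ofReal_realSgn]
    rw [h2, ← neg_inj, ← h1, Finset.sum_eq_single a]
    · rw [if_pos rfl, one_mul]
      simp only [eq_comm (a := b)]
      split_ifs
      · rw [Complex.ofReal_mul, ofReal_realSgn]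
        ring
      · simp
    · intro i _ hi
      simp [hi.symm]
    · simp

end LinearNormalization

end FormalCR

namespace FormalCR

open MvPowerSeries

/-! ### Automorphisms normalizing the linear part -/

section NormalizingAutomorphisms

variable {n k : ℕ}

theorem sgn_mul_self (ℓ : ℕ) {m : ℕ} (j : Fin m) : sgn ℓ j * sgn ℓ j = 1 := by
  unfold sgn; split_ifs <;> simp

/-- The coordinate functions dual to a basis which is orthogonal for the Hermitian form. -/
theorem dual_basis_of_orthogonal {ℓ' : ℕ} {u : ℝ} (hu : u ≠ 0)
    (e : Fin n ⊕ Fin k ≃ Fin (n + k)) (P : Fin n ⊕ Fin k → Fin (n + k) → ℂ)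
    (hP : ∀ a b, diagHerm (realSgn ℓ') (P a) (P b) =
      if a = b then (u : ℂ) * sgn ℓ' (e a) else 0) :
    ∃ N : Fin n ⊕ Fin k → Fin (n + k) → ℂ,
      (∀ b a, ∑ m, N b m * P a m = if a = b then 1 else 0) ∧
      (∀ m m', ∑ b, P b m * N b m' = if m = m' then 1 else 0) ∧
      ∀ m m', (u : ℂ) * ∑ b, sgn ℓ' (e b) * (N b m * starRingEnd ℂ (N b m')) =
        if m = m' then sgn ℓ' m else 0 := by
  classical
  have hu' : (u : ℂ) ≠ 0 := by exact_mod_cast hu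
  -- With `J`, `J'` the diagonal sign matrices in the two numberings, the orthogonality of `P` reads
  -- `Q* J Q = u J'`. So the inverse of `Q` is `u⁻¹ J' Q* J`.
  let N : Matrix (Fin n ⊕ Fin k) (Fin (n + k)) ℂ :=
    Matrix.of fun b m => sgn ℓ' (e b) / u * (sgn ℓ' m * starRingEnd ℂ (P b m))
  let Q : Matrix (Fin (n + k)) (Fin n ⊕ Fin k) ℂ := Matrix.of fun m a => P a m
  have h1 : ∀ b a, ∑ m, N b m * P a m = if a = b then 1 else 0 := by
    intro b a
    have h2 : ∑ m, N b m * P a m = sgn ℓ' (e b) / u * diagHerm (realSgn ℓ') (P a) (P b) := by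
      simp only [N, diagHerm, Matrix.of_apply, Finset.mul_sum, ofReal_realSgn]
      exact Finset.sum_congr rfl fun m _ => by ring
    rw [h2, hP]
    split_ifs with hab
    · subst hab
      rw [div_mul_eq_mul_div, mul_left_comm, sgn_mul_self, mul_one, div_self hu']
    · rw [mul_zero]
  have hNQ : N * Q = 1 := by
    ext b a
    rw [Matrix.mul_apply, Matrix.one_apply]
    simp only [Q, Matrix.of_apply, h1, eq_comm]
  have hQN : Q * N = 1 := (Matrix.mul_eq_one_comm_of_equiv e).mp hNQ
  have h2 : ∀ m m', ∑ b, P b m * N b m' = if m = m' then 1 else 0 := by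
    intro m m'
    have := congrFun (congrFun hQN m) m'
    rwa [Matrix.mul_apply, Matrix.one_apply] at this
  refine ⟨N, h1, h2, fun m m' => ?_⟩
  have h3 : (u : ℂ) * ∑ b, sgn ℓ' (e b) * (N b m * starRingEnd ℂ (N b m')) =
      sgn ℓ' m' * ∑ b, P b m' * N b m := by
    rw [Finset.mul_sum, Finset.mul_sum]
    refine Finset.sum_congr rfl fun b _ => ?_
    have h4 : starRingEnd ℂ (N b m') = sgn ℓ' (e b) / u * (sgn ℓ' m' * P b m') := by
      simp only [N, Matrix.of_apply, map_mul, map_div₀, conj_sgn, Complex.conj_ofReal,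
        Complex.conj_conj]
    rw [h4]
    have h5 := sgn_mul_self ℓ' (e b)
    field_simp
    linear_combination (N b m * sgn ℓ' m' * P b m') * h5
  rw [h3, h2]
  simp only [eq_comm (a := m')]
  split_ifs with h
  · rw [h, mul_one]
  · rw [mul_zero]

theorem hol_linearForm (c : Coord n → ℂ) :
    hol (linearForm c) = ∑ i, C (c i) * hol (X i) := by
  simp only [linearForm, hol_sum, hol_mul, hol_C]

theorem antihol_linearForm (c : Coord n → ℂ) :
    antihol (linearForm c) = ∑ i, C (starRingEnd ℂ (c i)) * antihol (X i) := by
  simp only [linearForm, antihol_sum, antihol_mul, antihol_C]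

theorem hermSq_comp_equiv {ι : Type*} [Fintype ι] {p m : ℕ} (e : ι ≃ Fin m) (s : ℕ)
    (φ : Fin m → HolSeries p) :
    hermSq s φ = ∑ b, C (sgn s (e b)) * (hol (φ (e b)) * antihol (φ (e b))) :=
  (Equiv.sum_comp e fun j => C (sgn s j) * (hol (φ j) * antihol (φ j))).symm

/-- The invariance of the Hermitian form under the isotropy transformation with
parameter `α`. -/
theorem isotropy_identity {R ι : Type*} [CommRing R] [Fintype ι] (i c s2 : R) (W W' : R)
    (hc : c * (2 * i) = 1) (s α α' ν ν' : ι → R)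
    (hs2 : s2 = ∑ b, s b * (α b * α' b)) :
    c * (W * (1 - 2 * i * (∑ b, s b * (α b * ν' b)) + i * s2 * W') -
      (1 + 2 * i * (∑ b, s b * (α' b * ν b)) - i * s2 * W) * W') -
        ∑ b, s b * ((ν b - α b * W) * (ν' b - α' b * W')) =
      c * (W - W') - ∑ b, s b * (ν b * ν' b) := by
  have h1 : ∑ b, s b * ((ν b - α b * W) * (ν' b - α' b * W')) =
      ∑ b, s b * (ν b * ν' b) - W' * (∑ b, s b * (α' b * ν b)) -
        W * (∑ b, s b * (α b * ν' b)) + s2 * (W * W') := by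
    rw [hs2, Finset.mul_sum, Finset.mul_sum, Finset.sum_mul, ← Finset.sum_sub_distrib,
      ← Finset.sum_sub_distrib, ← Finset.sum_add_distrib]
    exact Finset.sum_congr rfl fun b _ => by ring
  rw [h1]
  linear_combination (s2 * W * W' - W * (∑ b, s b * (α b * ν' b)) -
    W' * (∑ b, s b * (α' b * ν b))) * hc

/-- A linear fractional automorphism of the hyperquadric which straightens the basis dual to
the linear forms `N` and has isotropy parameter `α`. -/
theorem exists_linearFractional {ℓ' : ℕ} {u : ℝ} (hu : u ≠ 0) (e : Fin n ⊕ Fin k ≃ Fin (n + k))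
    (P N : Fin n ⊕ Fin k → Fin (n + k) → ℂ) (α : Fin n ⊕ Fin k → ℂ)
    (hPN : ∀ m m', ∑ b, P b m * N b m' = if m = m' then 1 else 0)
    (hN : ∀ m m', (u : ℂ) * ∑ b, sgn ℓ' (e b) * (N b m * starRingEnd ℂ (N b m')) =
        if m = m' then sgn ℓ' m else 0) :
    ∃ (c : Coord (n + k) → Coord (n + k) → ℂ) (a : Coord (n + k) → ℂ),
      IsUnit (Matrix.of c) ∧
      C (u : ℂ) * homForm ℓ' (1 + linearForm a) (linearForm (c (Sum.inr ())))
        (fun j => linearForm (c (Sum.inl j))) = quadricSeries (n + k) ℓ' ∧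
      (c (Sum.inr ()) = Sum.elim (fun _ => 0) fun _ => (1 / u : ℂ)) ∧
      ∀ b, c (Sum.inl (e b)) = Sum.elim (N b) fun _ => -α b / u := by
  classical
  have hu' : (u : ℂ) ≠ 0 := by exact_mod_cast hu
  -- In the coordinates `ν` dual to `P` and with `W = w / u`, this is the classical isotropy map: `ν
  -- - α W` and `W`, over the denominator `1 + 2i ⟨ν, ᾱ⟩ - i ⟨α, ᾱ⟩ W`.
  let c : Coord (n + k) → Coord (n + k) → ℂ :=
    Sum.elim (fun i => Sum.elim (N (e.symm i)) fun _ => -α (e.symm i) / u)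
      (fun _ => Sum.elim (fun _ => 0) fun _ => (1 / u : ℂ))
  let s2 : ℂ := ∑ b, sgn ℓ' (e b) * (α b * starRingEnd ℂ (α b))
  let a : Coord (n + k) → ℂ :=
    Sum.elim (fun m => 2 * Complex.I * ∑ b, sgn ℓ' (e b) * (starRingEnd ℂ (α b) * N b m))
      fun _ => -(Complex.I * s2) / u
  have hcb : ∀ b, c (Sum.inl (e b)) = Sum.elim (N b) fun _ => -α b / u := by
    intro b
    simp [c]
  refine ⟨c, a, ?_, ?_, rfl, hcb⟩
  · rw [← Matrix.mulVec_injective_iff_isUnit]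
    have hlin : ∀ x : Coord (n + k) → ℂ, (Matrix.of c).mulVec x = 0 → x = 0 := by
      intro x hx
      have hxw : x (Sum.inr ()) = 0 := by
        have := congrFun hx (Sum.inr ())
        simpa [Matrix.mulVec, dotProduct, c, hu] using this
      have hxz : ∀ b, ∑ m, N b m * x (Sum.inl m) = 0 := by
        intro b
        have := congrFun hx (Sum.inl (e b))
        simpa [Matrix.mulVec, dotProduct, hcb, hxw] using this
      funext i
      rcases i with m | i
      · have h1 : ∑ b, P b m * ∑ m', N b m' * x (Sum.inl m') = x (Sum.inl m) := by
          simp only [Finset.mul_sum, ← mul_assoc]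
          rw [Finset.sum_comm]
          simp only [← Finset.sum_mul, hPN]
          simp
        rw [← h1]
        simp [hxz]
      · exact hxw
    intro x y hxy
    rw [← sub_eq_zero]
    apply hlin
    rw [Matrix.mulVec_sub]
    exact sub_eq_zero.mpr hxy
  · have hs2 : starRingEnd ℂ s2 = s2 := by
      simp only [s2, map_sum, map_mul, conj_sgn, Complex.conj_conj]
      exact Finset.sum_congr rfl fun b _ => by ring
    obtain ⟨z, hz⟩ : ∃ z : Fin (n + k) → MixedSeries (n + k), z = fun m => hol (X (Sum.inl m)) :=
      ⟨_, rfl⟩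
    obtain ⟨z', hz'⟩ : ∃ z' : Fin (n + k) → MixedSeries (n + k),
      z' = fun m => antihol (X (Sum.inl m)) := ⟨_, rfl⟩
    obtain ⟨w, hw⟩ : ∃ w : MixedSeries (n + k), w = hol (X (Sum.inr ())) := ⟨_, rfl⟩
    obtain ⟨w', hw'⟩ : ∃ w' : MixedSeries (n + k), w' = antihol (X (Sum.inr ())) := ⟨_, rfl⟩
    let ν : Fin n ⊕ Fin k → MixedSeries (n + k) := fun b => ∑ m, C (N b m) * z m
    let ν' : Fin n ⊕ Fin k → MixedSeries (n + k) := fun b =>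
      ∑ m, C (starRingEnd ℂ (N b m)) * z' m
    have e1 : hol (linearForm (c (Sum.inr ()))) = C (1 / u : ℂ) * w := by
      rw [hol_linearForm]
      simp [c, hw]
    have e2 : antihol (linearForm (c (Sum.inr ()))) = C (1 / u : ℂ) * w' := by
      rw [antihol_linearForm]
      simp [c, hw']
    have e3 : ∀ b, hol (linearForm (c (Sum.inl (e b)))) =
        ν b - C (α b) * (C (1 / u : ℂ) * w) := by
      intro b
      rw [hol_linearForm, hcb, Fintype.sum_sum_type]
      simp only [Sum.elim_inl, Sum.elim_inr, Finset.univ_unique, Finset.sum_singleton, ν, hz, hw]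
      rw [sub_eq_add_neg, ← mul_assoc, ← map_mul, ← neg_mul, ← map_neg]
      congr 4
      ring
    have e4 : ∀ b, antihol (linearForm (c (Sum.inl (e b)))) =
        ν' b - C (starRingEnd ℂ (α b)) * (C (1 / u : ℂ) * w') := by
      intro b
      rw [antihol_linearForm, hcb, Fintype.sum_sum_type]
      simp only [Sum.elim_inl, Sum.elim_inr, Finset.univ_unique, Finset.sum_singleton, ν', hz',
        hw']
      rw [sub_eq_add_neg, ← mul_assoc, ← map_mul, ← neg_mul, ← map_neg]
      congr 4
      rw [map_div₀, map_neg, Complex.conj_ofReal]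
      ring
    have e5 : hol (1 + linearForm a) = 1 + 2 * C Complex.I * (∑ b, C (sgn ℓ' (e b)) *
        (C (starRingEnd ℂ (α b)) * ν b)) - C Complex.I * C s2 * (C (1 / u : ℂ) * w) := by
      rw [hol_add, hol_one, hol_linearForm, Fintype.sum_sum_type, add_sub_assoc]
      congr 1
      simp only [a, Sum.elim_inl, Sum.elim_inr, Finset.univ_unique, Finset.sum_singleton]
      rw [sub_eq_add_neg]
      congr 1
      · simp only [ν, hz, map_mul, map_sum, Finset.mul_sum, Finset.sum_mul]
        rw [Finset.sum_comm]
        refine Finset.sum_congr rfl fun b _ => Finset.sum_congr rfl fun m _ => ?_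
        rw [show (C (2 : ℂ) : MixedSeries (n + k)) = 2 from map_ofNat C 2]
        ring
      · have h1 : (C (-(Complex.I * s2) / u) : MixedSeries (n + k)) =
            -(C Complex.I * C s2 * C (1 / u : ℂ)) := by
          rw [← map_mul, ← map_mul, ← map_neg]
          congr 1
          ring
        rw [h1, hw, neg_mul, mul_assoc]
    have e6 : antihol (1 + linearForm a) = 1 - 2 * C Complex.I * (∑ b, C (sgn ℓ' (e b)) *
        (C (α b) * ν' b)) + C Complex.I * C s2 * (C (1 / u : ℂ) * w') := by
      rw [antihol_add, antihol_one, antihol_linearForm, Fintype.sum_sum_type, sub_add]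
      rw [sub_eq_add_neg]
      congr 1
      simp only [a, Sum.elim_inl, Sum.elim_inr, Finset.univ_unique, Finset.sum_singleton]
      rw [neg_sub, sub_eq_neg_add]
      congr 1
      · simp only [ν', hz', map_mul, map_sum, Finset.mul_sum, Finset.sum_mul, conj_sgn,
          Complex.conj_conj, Complex.conj_I, map_neg, Complex.conj_ofNat]
        rw [Finset.sum_comm, ← Finset.sum_neg_distrib]
        refine Finset.sum_congr rfl fun b _ => ?_
        rw [← Finset.sum_neg_distrib]
        refine Finset.sum_congr rfl fun m _ => ?_
        rw [show (C (2 : ℂ) : MixedSeries (n + k)) = 2 from map_ofNat C 2]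
        ring
      · rw [hw', ← mul_assoc, ← map_mul, ← map_mul]
        congr 2
        rw [map_div₀, map_neg, map_mul, hs2, Complex.conj_I, Complex.conj_ofReal]
        ring
    have hc2 : (C (1 / (2 * Complex.I)) : MixedSeries (n + k)) * (2 * C Complex.I) = 1 := by
      rw [← map_ofNat C 2, ← map_mul, ← map_mul, one_div, inv_mul_cancel₀ (by simp), map_one]
    have hkey := isotropy_identity (C Complex.I) (C (1 / (2 * Complex.I))) (C s2)
      (C (1 / u : ℂ) * w) (C (1 / u : ℂ) * w') hc2 (fun b => C (sgn ℓ' (e b)))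
      (fun b => C (α b)) (fun b => C (starRingEnd ℂ (α b))) ν ν' (by
        simp only [s2, map_sum, map_mul])
    have hνν : C (u : ℂ) * ∑ b, C (sgn ℓ' (e b)) * (ν b * ν' b) =
        ∑ m, C (sgn ℓ' m) * (z m * z' m) := by
      have h1 : C (u : ℂ) * ∑ b, C (sgn ℓ' (e b)) * (ν b * ν' b) =
          ∑ m, ∑ m', C ((u : ℂ) * ∑ b, sgn ℓ' (e b) * (N b m * starRingEnd ℂ (N b m'))) *
            (z m * z' m') := by
        simp only [ν, ν', map_mul, map_sum, Finset.mul_sum, Finset.sum_mul]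
        conv_rhs => rw [Finset.sum_comm]
        rw [Finset.sum_comm]
        refine Finset.sum_congr rfl fun m _ => ?_
        rw [Finset.sum_comm]
        refine Finset.sum_congr rfl fun m' _ => Finset.sum_congr rfl fun b _ => ?_
        ring
      rw [h1]
      refine Finset.sum_congr rfl fun m _ => ?_
      rw [Finset.sum_eq_single m]
      · rw [hN, if_pos rfl]
      · intro m' _ hm'
        rw [hN, if_neg hm'.symm, map_zero, zero_mul]
      · simp
    rw [homForm, hermSq_comp_equiv e]
    simp only [e1, e2, e3, e4, e5, e6]
    rw [hkey, mul_sub, hνν, quadricSeries, hermSq, hz, hz', hw, hw', ← mul_sub, mul_left_comm,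
      ← mul_assoc (C (u : ℂ)), ← map_mul, mul_one_div_cancel hu', map_one, one_mul]

/-- Replacing the denominator by adding a real multiple of the last coordinate does not change
the Hermitian form. -/
theorem homForm_sub_real_mul {p : ℕ} (ℓ : ℕ) (r : ℝ) (h g : HolSeries n)
    (f : Fin p → HolSeries n) : homForm ℓ (h - C (r : ℂ) * g) g f = homForm ℓ h g f := by
  simp only [homForm, hol_sub, antihol_sub, hol_mul, antihol_mul, hol_C, antihol_C,
    Complex.conj_ofReal]
  ring

/-- Normalization of the first order terms of a transversal embedding by automorphisms of the
hyperquadric. -/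
theorem exists_normalization {ℓ ℓ' : ℕ} (hℓℓ' : ℓ ≤ ℓ') (hℓ : ℓ' + ℓ < n)
    (H : FormalMap n (n + k)) (hH : FixesZero H)
    (htrans : ∃ j, coeff (Finsupp.single j 1) (H (Sum.inr ())) ≠ 0) (A : MixedSeries n)
    (hA : 3 ≤ A.order) (U : MixedSeries n)
    (hU : U * (quadricSeries n ℓ - A) = pullback H (quadricSeries (n + k) ℓ')) :
    ∃ (e : Fin n ⊕ Fin k ≃ Fin (n + k)) (c : Coord (n + k) → Coord (n + k) → ℂ)
      (a : Coord (n + k) → ℂ) (u : ℝ), IsRenumbering ℓ ℓ' e ∧ u ≠ 0 ∧ constantCoeff U = u ∧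
      IsUnit (Matrix.of c) ∧
      C (u : ℂ) * homForm ℓ' (1 + linearForm a) (linearForm (c (Sum.inr ())))
        (fun j => linearForm (c (Sum.inl j))) = quadricSeries (n + k) ℓ' ∧
      (∀ j, 2 ≤ (subst H (linearForm (c (Sum.inl (e (Sum.inl j))))) - X (Sum.inl j)).order) ∧
      (∀ j, 2 ≤ (subst H (linearForm (c (Sum.inl (e (Sum.inr j)))))).order) ∧
      2 ≤ (subst H (linearForm (c (Sum.inr ()))) - X (Sum.inr ())).order := by
  classical
  obtain ⟨u, hu, hUu, hw, hherm⟩ := linear_part_of_mul_quadric_eq H hH htrans A hA U hU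
  have hupos := pos_of_orthogonal_family hℓ hu _ hherm
  have hu' : (u : ℂ) ≠ 0 := by exact_mod_cast hu
  obtain ⟨e, P, he, hPv, hP⟩ := exists_isometric_extension hℓℓ' hℓ hupos _ hherm
  obtain ⟨N, hN1, hN2, hN3⟩ := dual_basis_of_orthogonal hu e P hP
  -- The isotropy parameter is the `w`-derivative of `H` in the dual basis. Since the last component
  -- of `H` has linear part `u w`, the term `-α w / u` removes this derivative.
  obtain ⟨c, a, hc, hform, hcw, hcb⟩ := exists_linearFractional hu e P N
    (fun b => ∑ m, N b m * coeff (Finsupp.single (Sum.inr ()) 1) (H (Sum.inl m))) hN2 hN3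
  have hord : ∀ f : HolSeries n, constantCoeff f = 0 →
      (∀ j, coeff (Finsupp.single j 1) f = 0) → 2 ≤ f.order := by
    intro f h0 h1
    apply le_order
    intro d hd
    have hd' : d.degree < 2 := by exact_mod_cast hd
    rcases Nat.lt_or_ge d.degree 1 with h | h
    · rw [(Finsupp.degree_eq_zero_iff d).mp (by omega), coeff_zero_eq_constantCoeff_apply, h0]
    · obtain ⟨j, rfl⟩ := exists_eq_single_of_degree_eq_one (by omega : d.degree = 1)
      exact h1 j
  have hconst : ∀ c, constantCoeff (subst H (linearForm c)) = 0 := fun c => by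
    rw [constantCoeff_subst_fixesZero hH, constantCoeff_linearForm]
  have hlin : ∀ c j, coeff (Finsupp.single j 1) (subst H (linearForm c)) =
      ∑ m, c (Sum.inl m) * coeff (Finsupp.single j 1) (H (Sum.inl m)) +
        c (Sum.inr ()) * coeff (Finsupp.single j 1) (H (Sum.inr ())) := by
    intro c j
    rw [coeff_single_subst hH]
    simp only [coeff_single_linearForm, Fintype.sum_sum_type, Finset.univ_unique,
      Finset.sum_singleton]
  have hb : ∀ b j, coeff (Finsupp.single j 1) (subst H (linearForm (c (Sum.inl (e b))))) =
      Sum.elim (fun i => if Sum.inl i = b then 1 else 0) (fun _ => 0) j := by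
    intro b j
    rw [hlin, hcb, hw]
    simp only [Sum.elim_inl, Sum.elim_inr]
    rcases j with j | j
    · rw [if_neg (by simp), mul_zero, add_zero, Sum.elim_inl, ← hN1, hPv]
    · rw [if_pos rfl, Sum.elim_inr, div_mul_cancel₀ _ hu']
      exact add_neg_cancel _
  refine ⟨e, c, a, u, he, hu, hUu, hc, hform, fun j => ?_, fun j => ?_, ?_⟩
  · apply hord
    · rw [map_sub, hconst, constantCoeff_X, sub_zero]
    · rintro (i | i) <;> rw [map_sub, hb, coeff_index_single_X]
      · simp
      · simp
  · apply hord
    · rw [hconst]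
    · rintro (i | i) <;> rw [hb] <;> simp
  · apply hord
    · rw [map_sub, hconst, constantCoeff_X, sub_zero]
    · intro i
      rw [map_sub, hlin, hcw, hw, coeff_index_single_X]
      simp only [Sum.elim_inl, Sum.elim_inr, zero_mul, Finset.sum_const_zero,
        zero_add]
      split_ifs
      · rw [one_div, inv_mul_cancel₀ hu', sub_self]
      · simp

end NormalizingAutomorphisms

end FormalCR

namespace FormalCR

open MvPowerSeries

/-! ### Graph coordinates for the two embeddings -/

section Main

variable {n k : ℕ}

theorem two_le_order_subst {H : FormalMap n k} (hH : FixesZero H) {f : HolSeries k}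
    (hf : 2 ≤ f.order) : 2 ≤ (subst H f).order := by
  refine le_trans ?_ (le_order_subst hH.hasSubst f)
  have h2 : (1 : ℕ∞) ≤ ⨅ i, (H i).order := le_iInf fun i =>
    one_le_order_iff_constCoeff_eq_zero.mpr (hH i)
  refine le_trans ?_ (mul_le_mul' h2 hf)
  simp

theorem two_le_order_mul {f g : HolSeries n} (hf : 2 ≤ f.order) : 2 ≤ (g * f).order :=
  le_trans (le_add_left hf) le_order_mul

theorem constantCoeff_of_two_le_order_sub_X {f : HolSeries n} {i : Coord n}
    (hf : 2 ≤ (f - X i).order) : constantCoeff f = 0 := by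
  have h := coeff_eq_zero_of_degree_lt_two hf (α := 0) (by simp)
  simpa using h

theorem two_le_order_mul_sub_X {f g : HolSeries n} {i : Coord n} (hf : 2 ≤ (f - X i).order)
    (hg : constantCoeff g = 1) : 2 ≤ (g * f - X i).order := by
  have h1 : g * f - X i = (g - 1) * f + (f - X i) := by ring
  rw [h1]
  refine le_order_add (le_trans ?_ le_order_mul) hf
  have h2 : (1 : ℕ∞) ≤ f.order := one_le_order_iff_constCoeff_eq_zero.mpr
    (constantCoeff_of_two_le_order_sub_X hf)
  have h3 : (1 : ℕ∞) ≤ (g - 1).order := one_le_order_iff_constCoeff_eq_zero.mpr (by simp [hg])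
  exact le_trans (by norm_num) (add_le_add h3 h2)

theorem pullback_dvd {H : FormalMap n k} (hH : FixesZero H) {A B : MixedSeries k} (h : A ∣ B) :
    pullback H A ∣ pullback H B := by
  obtain ⟨D, rfl⟩ := h
  exact ⟨pullback H D, pullback_mul hH A D⟩

/-- The linear part of the equation involves only `w` and `w̄`, so the condition on `v` implies
tangency and is stable under multiplication by `i`. -/
theorem tangent_complexTangent_hyperquadric (ℓ : ℕ) {v : Coord n → ℂ} (hv : v (Sum.inr ()) = 0) :
    v ∈ complexTangent (hyperquadric n ℓ) := by
  classical
  have h1 : ∀ v : Coord n → ℂ, v (Sum.inr ()) = 0 → v ∈ tangent (hyperquadric n ℓ) := by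
    intro v hv
    have h2 : ∀ i, coeff (Finsupp.single (Sum.inl (Sum.inl i)) 1) (quadricSeries n ℓ) = 0 := by
      intro i
      rw [← Finsupp.sumElim_single_zero, coeff_quadricSeries]
      simp [coeff_index_single_X, coeff_zero_X]
    have h3 : ∀ i, coeff (Finsupp.single (Sum.inr (Sum.inl i)) 1) (quadricSeries n ℓ) = 0 := by
      intro i
      rw [← Finsupp.sumElim_zero_single, coeff_quadricSeries]
      simp [coeff_index_single_X, coeff_zero_X]
    change _ + _ = (0 : ℂ)
    simp only [Fintype.sum_sum_type, hyperquadric, h2, h3]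
    simp [hv]
  refine ⟨h1 v hv, -Complex.I • v, h1 _ (by simp [hv]), ?_⟩
  simp [smul_smul]

/-- Otherwise the last row of the Jacobian of `H` vanishes, `Φ` being invertible, and then all of
`dH` takes values in the complex tangent space. -/
theorem exists_coeff_ne_zero_of_transversal {M : FormalHypersurface n} {ℓ : ℕ}
    {H : FormalMap n k} (hH : IsCRTransversalEmbedding H M (hyperquadric k ℓ))
    {Φ : FormalMap n n} (hΦ : IsFormalBiholomorphism Φ) :
    ∃ j, coeff (Finsupp.single j 1) (comp H Φ (Sum.inr ())) ≠ 0 := by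
  by_contra hcon
  push Not at hcon
  apply hH.transversal
  have h1 : jac H (Sum.inr ()) = 0 := by
    have h2 : Matrix.vecMul (jac H (Sum.inr ())) (jac Φ) = 0 := by
      funext j
      have h3 := hcon j
      have h4 : jac (comp H Φ) (Sum.inr ()) j = 0 := h3
      rw [jac_comp hΦ.fixesZero] at h4
      exact h4
    have h5 := Matrix.vecMul_injective_of_isUnit hΦ.jac_isUnit
    exact h5 (h2.trans (Matrix.zero_vecMul _).symm)
  rintro _ ⟨v, -, rfl⟩
  apply tangent_complexTangent_hyperquadric
  change jac H (Sum.inr ()) ⬝ᵥ v = 0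
  rw [h1, zero_dotProduct]

theorem hermSq_of_isRenumbering {p ℓ ℓ' : ℕ} {e : Fin n ⊕ Fin k ≃ Fin (n + k)}
    (he : IsRenumbering ℓ ℓ' e) (f : Fin (n + k) → HolSeries p) :
    hermSq ℓ' f = hermSq ℓ (fun j => f (e (Sum.inl j))) +
      hermSq (ℓ' - ℓ) fun j => f (e (Sum.inr j)) := by
  rw [hermSq_comp_equiv e, Fintype.sum_sum_type]
  simp only [he.1, he.2, hermSq]

/-- This lets the equation of a graph serve as the equation with third order remainder in
`exists_normalization`. -/
theorem three_le_order_hermSq (s : ℕ) (φ : Fin k → HolSeries n) (hφ : ∀ j, 2 ≤ (φ j).order) :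
    3 ≤ (hermSq s φ).order := by
  apply le_order
  intro d hd
  rw [← Finsupp.comapDomain_sumElim_comapDomain d] at hd ⊢
  generalize d.comapDomain Sum.inl _ = α at *
  generalize d.comapDomain Sum.inr _ = β at *
  have h1 : (α.sumElim β).degree = α.degree + β.degree := by
    simp [Finsupp.degree_eq_sum]
  rw [h1] at hd
  have hd' : α.degree + β.degree < 3 := by exact_mod_cast hd
  rw [coeff_hermSq]
  refine Finset.sum_eq_zero fun j _ => ?_
  by_cases h : α.degree < 2
  · simp [coeff_eq_zero_of_degree_lt_two (hφ j) h]
  · simp [coeff_eq_zero_of_degree_lt_two (hφ j) (by omega : β.degree < 2)]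

theorem comp_linearFractional_mul {m : ℕ} (c : Coord m → Coord m → ℂ) (a : Coord m → ℂ)
    {H : FormalMap n m} (hH : FixesZero H) (i : Coord m) :
    comp (fun i => linearForm (c i) * (1 + linearForm a)⁻¹) H i * subst H (1 + linearForm a) =
      subst H (linearForm (c i)) := by
  rw [comp, ← subst_mul hH.hasSubst, mul_assoc, MvPowerSeries.inv_mul_cancel _
    (by simp [constantCoeff_linearForm]), mul_one]

theorem jac_eq_one {Ψ : FormalMap n n} (hΨ : ∀ i, 2 ≤ (Ψ i - X i).order) : jac Ψ = 1 := by
  classical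
  ext i j
  have h := coeff_eq_zero_of_degree_lt_two (hΨ i) (α := Finsupp.single j 1) (by simp)
  rw [map_sub, sub_eq_zero, coeff_index_single_X] at h
  rw [jac, Matrix.of_apply, h, Matrix.one_apply]
  simp only [eq_comm]

theorem fixesZero_graphMap (e : Fin n ⊕ Fin k ≃ Fin (n + k)) {φ : Fin k → HolSeries n}
    (hφ : ∀ j, 2 ≤ (φ j).order) : FixesZero (graphMap e φ) := by
  rintro (i | i)
  · obtain ⟨b, rfl⟩ := e.surjective i
    rcases b with j | j
    · simp [graphMap]
    · simpa [graphMap] using coeff_eq_zero_of_degree_lt_two (hφ j) (α := 0) (by simp)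
  · simp [graphMap]

theorem eq_graphMap {G : FormalMap n (n + k)} {e : Fin n ⊕ Fin k ≃ Fin (n + k)}
    {φ : Fin k → HolSeries n} (hw : G (Sum.inr ()) = X (Sum.inr ()))
    (hz : ∀ j, G (Sum.inl (e (Sum.inl j))) = X (Sum.inl j))
    (hφ : ∀ j, G (Sum.inl (e (Sum.inr j))) = φ j) : G = graphMap e φ := by
  funext i
  rcases i with i | i
  · obtain ⟨b, rfl⟩ := e.surjective i
    rcases b with j | j
    · simp [graphMap, hz]
    · simp [graphMap, hφ]
  · simp [graphMap, hw]

theorem pullback_graphMap {ℓ ℓ' : ℕ} {e : Fin n ⊕ Fin k ≃ Fin (n + k)}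
    (he : IsRenumbering ℓ ℓ' e) {φ : Fin k → HolSeries n} (hφ : ∀ j, 2 ≤ (φ j).order) :
    pullback (graphMap e φ) (quadricSeries (n + k) ℓ') =
      quadricSeries n ℓ - hermSq (ℓ' - ℓ) φ := by
  rw [pullback_quadricSeries (fixesZero_graphMap e hφ), hermSq_of_isRenumbering he, quadricSeries]
  simp [graphMap, sub_sub]

/-- A transversal embedding becomes a graph over suitable coordinates. -/
theorem exists_graph_coordinates {ℓ ℓ' : ℕ} (hℓℓ' : ℓ ≤ ℓ') (hℓ : ℓ' + ℓ < n)
    (H : FormalMap n (n + k)) (hH : FixesZero H)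
    (htrans : ∃ j, coeff (Finsupp.single j 1) (H (Sum.inr ())) ≠ 0) (A : MixedSeries n)
    (hA : 3 ≤ A.order)
    (hdvd : quadricSeries n ℓ - A ∣ pullback H (quadricSeries (n + k) ℓ')) :
    ∃ (e : Fin n ⊕ Fin k ≃ Fin (n + k)) (T : FormalMap (n + k) (n + k)) (Ψ : FormalMap n n)
      (φ : Fin k → HolSeries n), IsRenumbering ℓ ℓ' e ∧ IsLocalAut T (hyperquadric (n + k) ℓ') ∧
      IsFormalBiholomorphism Ψ ∧ (∀ j, 2 ≤ (φ j).order) ∧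
      comp (comp T H) Ψ = graphMap e φ ∧
      quadricSeries n ℓ - hermSq (ℓ' - ℓ) φ ∣ pullback Ψ (quadricSeries n ℓ - A) := by
  obtain ⟨U, hU⟩ := hdvd
  rw [mul_comm] at hU
  obtain ⟨e, c, a, u, he, hu, hUu, hc, hform, hz, hφ, hw⟩ :=
    exists_normalization hℓℓ' hℓ H hH htrans A hA U hU.symm
  have hT := isLocalAut_linearFractional c a (by exact_mod_cast hu : (u : ℂ) ≠ 0) hc hform
  obtain ⟨T, hTdef⟩ : ∃ T : FormalMap (n + k) (n + k),
    T = fun i => linearForm (c i) * (1 + linearForm a)⁻¹ := ⟨_, rfl⟩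
  rw [← hTdef] at hT
  have hδ : constantCoeff (subst H (1 + linearForm a)) = 1 := by
    rw [constantCoeff_subst_fixesZero hH]
    simp [constantCoeff_linearForm]
  have hG : ∀ i, comp T H i =
      (subst H (1 + linearForm a))⁻¹ * subst H (linearForm (c i)) := by
    intro i
    rw [mul_comm, MvPowerSeries.eq_mul_inv_iff_mul_eq (by rw [hδ]; exact one_ne_zero), hTdef,
      comp_linearFractional_mul c a hH]
  have hδ' : constantCoeff (subst H (1 + linearForm a))⁻¹ = 1 := by
    rw [constantCoeff_inv, hδ, inv_one]
  have hTH : FixesZero (comp T H) := hT.biholomorphism.fixesZero.comp hH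
  -- The `z` and `w` components of the normalized embedding are tangent to the identity, and their
  -- inverse provides the new coordinates.
  obtain ⟨Ψ, hΨ2, hΨ⟩ := exists_subst_eq_X (σ := Coord n)
    (Sum.elim (fun j => comp T H (Sum.inl (e (Sum.inl j)))) fun _ => comp T H (Sum.inr ())) (by
      rintro (j | j)
      · rw [Sum.elim_inl, hG]
        exact two_le_order_mul_sub_X (hz j) hδ'
      · rw [Sum.elim_inr, hG]
        exact two_le_order_mul_sub_X hw hδ')
  have hΨ0 : FixesZero Ψ := fun i => constantCoeff_of_two_le_order_sub_X (hΨ2 i)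
  have hφ2 : ∀ j, 2 ≤ (subst Ψ (comp T H (Sum.inl (e (Sum.inr j))))).order := by
    intro j
    apply two_le_order_subst hΨ0
    rw [hG]
    exact two_le_order_mul (hφ j)
  have hgraph : comp (comp T H) Ψ =
      graphMap e fun j => subst Ψ (comp T H (Sum.inl (e (Sum.inr j)))) :=
    eq_graphMap (hΨ (Sum.inr ())) (fun j => hΨ (Sum.inl j)) fun j => rfl
  refine ⟨e, T, Ψ, _, he, hT, ⟨hΨ0, by rw [jac_eq_one hΨ2]; exact isUnit_one⟩, hφ2, hgraph, ?_⟩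
  -- The graph equation is the pullback of the quadric. Since `u ≠ 0`, the factor `U` is a unit, so
  -- this pullback divides the equation of `M` as well as being divisible by it.
  rw [← pullback_graphMap he hφ2, ← hgraph, ← pullback_pullback hTH hΨ0]
  apply pullback_dvd hΨ0
  rw [← pullback_pullback hT.biholomorphism.fixesZero hH]
  refine (pullback_dvd hH hT.preserves.dvd).trans ?_
  change pullback H (quadricSeries (n + k) ℓ') ∣ _
  rw [hU]
  refine (IsUnit.mul_left_dvd ?_).mpr dvd_rfl
  rw [isUnit_iff_constantCoeff, hUu]
  exact (by exact_mod_cast hu : (u : ℂ) ≠ 0).isUnit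

/-- The restriction of a series in `(Z, Z̄)` to `Z̄ = 0`. -/
noncomputable def holPart (A : MixedSeries n) : HolSeries n := killCompl Function.Embedding.inl A

theorem coeff_holPart (A : MixedSeries n) (α : Coord n →₀ ℕ) :
    coeff α (holPart A) = coeff (α.sumElim 0) A := by
  rw [holPart, coeff_killCompl, Finsupp.embDomain_inl]

theorem holPart_mul (A B : MixedSeries n) : holPart (A * B) = holPart A * holPart B :=
  map_mul _ A B

theorem holPart_hol (f : HolSeries n) : holPart (hol f) = f := by
  ext α
  rw [coeff_holPart, coeff_hol, if_pos rfl]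

theorem holPart_antihol (f : HolSeries n) :
    holPart (antihol f) = C (starRingEnd ℂ (constantCoeff f)) := by
  classical
  ext α
  rw [coeff_holPart, coeff_antihol, coeff_C, coeff_zero_eq_constantCoeff_apply]

/-- Coordinates in which one embedding is a graph are adapted to every other embedding of small
codimension. -/
theorem exists_graph_of_graph {k₁ k₂ ℓ s₁ ℓ₂ : ℕ} (hk : k₁ + k₂ < n) (hℓ₂ : ℓ ≤ ℓ₂)
    (hℓ : ℓ₂ + ℓ < n) (φ₁ : Fin k₁ → HolSeries n) (hφ₁ : ∀ j, 2 ≤ (φ₁ j).order)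
    (H : FormalMap n (n + k₂)) (hH : FixesZero H)
    (htrans : ∃ j, coeff (Finsupp.single j 1) (H (Sum.inr ())) ≠ 0)
    (hdvd : quadricSeries n ℓ - hermSq s₁ φ₁ ∣ pullback H (quadricSeries (n + k₂) ℓ₂)) :
    ∃ (e : Fin n ⊕ Fin k₂ ≃ Fin (n + k₂)) (T : FormalMap (n + k₂) (n + k₂))
      (φ₂ : Fin k₂ → HolSeries n), IsRenumbering ℓ ℓ₂ e ∧
      IsLocalAut T (hyperquadric (n + k₂) ℓ₂) ∧ (∀ j, 2 ≤ (φ₂ j).order) ∧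
      comp T H = graphMap e φ₂ ∧ hermSq s₁ φ₁ = hermSq (ℓ₂ - ℓ) φ₂ := by
  obtain ⟨U₀, hU₀⟩ := hdvd
  rw [mul_comm] at hU₀
  obtain ⟨e, c, a, u, he, hu, hUu, hc, hform, hz, hφ, hw⟩ :=
    exists_normalization hℓ₂ hℓ H hH htrans (hermSq s₁ φ₁) (three_le_order_hermSq s₁ φ₁ hφ₁) U₀
      hU₀.symm
  have hu' : (u : ℂ) ≠ 0 := by exact_mod_cast hu
  obtain ⟨f, hf⟩ : ∃ f : Coord (n + k₂) → HolSeries n, f = fun i => subst H (linearForm (c i)) :=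
    ⟨_, rfl⟩
  obtain ⟨δ, hδ⟩ : ∃ δ : HolSeries n, δ = subst H (1 + linearForm a) := ⟨_, rfl⟩
  have hδ1 : constantCoeff δ = 1 := by
    rw [hδ, constantCoeff_subst_fixesZero hH]
    simp [constantCoeff_linearForm]
  have hpull : C (u : ℂ) * homForm ℓ₂ δ (f (Sum.inr ())) (fun j => f (Sum.inl j)) =
      U₀ * (quadricSeries n ℓ - hermSq s₁ φ₁) := by
    rw [← hU₀, ← hform, pullback_mul hH, pullback_C, pullback_homForm hH, hδ, hf]
  obtain ⟨V, hV⟩ : ∃ V : MixedSeries n, V = C (u : ℂ)⁻¹ * U₀ := ⟨_, rfl⟩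
  have hpull' : homForm ℓ₂ δ (f (Sum.inr ())) (fun j => f (Sum.inl j)) =
      V * (quadricSeries n ℓ - hermSq s₁ φ₁) := by
    rw [hV, mul_assoc, ← hpull, ← mul_assoc, ← map_mul, inv_mul_cancel₀ hu', map_one, one_mul]
  have hV1 : constantCoeff (holPart V) = 1 := by
    rw [← coeff_zero_eq_constantCoeff_apply, coeff_holPart, Finsupp.sumElim_zero_zero,
      coeff_zero_eq_constantCoeff_apply, hV, map_mul, hUu, constantCoeff_C, inv_mul_cancel₀ hu']
  -- Rescaling by `q` multiplies `V` by `hol q * antihol q`. At `Z̄ = 0` the second factor is `1`,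
  -- so `q = (holPart V)⁻¹` makes the new factor `1` there.
  obtain ⟨q, hq⟩ : ∃ q : HolSeries n, q = (holPart V)⁻¹ := ⟨_, rfl⟩
  have hq1 : constantCoeff q = 1 := by rw [hq, constantCoeff_inv, hV1, inv_one]
  have hφ2 : ∀ j, 2 ≤ (q * f (Sum.inl (e (Sum.inr j)))).order := by
    intro j
    rw [hf]
    exact two_le_order_mul (hφ j)
  obtain ⟨hgw, hfz, ⟨r, hr⟩, hherm⟩ := eq_of_mul_quadric_eq hk ℓ s₁ (ℓ₂ - ℓ) φ₁
    (fun j => q * f (Sum.inl (e (Sum.inr j)))) hφ₁ hφ2 (q * δ) (q * f (Sum.inr ()))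
    (fun j => q * f (Sum.inl (e (Sum.inl j)))) (hol q * antihol q * V)
    (by rw [map_mul, hq1, hδ1, mul_one])
    (by
      rw [map_mul, constantCoeff_of_two_le_order_sub_X (f := f (Sum.inr ())) (by rw [hf]; exact hw),
        mul_zero])
    (fun j => two_le_order_mul_sub_X (by rw [hf]; exact hz j) hq1)
    (by
      intro α
      rw [← coeff_holPart]
      have h1 : holPart (hol q * antihol q * V - 1) = 0 := by
        have h2 : holPart (hol q * antihol q * V - 1) = holPart (hol q * antihol q * V) - 1 := by
          simp [holPart]
        rw [h2, holPart_mul, holPart_mul, holPart_hol, holPart_antihol, hq1, map_one, map_one,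
          mul_one, hq, MvPowerSeries.inv_mul_cancel _ (by rw [hV1]; exact one_ne_zero), sub_self]
      rw [h1, map_zero])
    (by
      rw [mul_assoc, ← hpull', ← homForm_mul, homForm, hermSq_of_isRenumbering he, sub_sub])
  -- The remaining parameter `r` goes into the denominator. From `q δ = 1 + r w` and `q g = w` it
  -- follows that `q (δ - r g) = 1`, where `g = f (Sum.inr ())`, so `q` is exactly the inverse of
  -- the new denominator along `H`.
  let b : Coord (n + k₂) → ℂ := a - (r : ℂ) • c (Sum.inr ())
  have hb : 1 + linearForm b = 1 + linearForm a - C (r : ℂ) * linearForm (c (Sum.inr ())) := by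
    simp only [linearForm, b, Finset.mul_sum, add_sub_assoc, ← Finset.sum_sub_distrib,
      Pi.sub_apply, Pi.smul_apply, smul_eq_mul, map_sub, map_mul]
    congr 1
    exact Finset.sum_congr rfl fun i _ => by ring
  have hT := isLocalAut_linearFractional (ℓ := ℓ₂) c b hu' hc (by
    rw [hb, homForm_sub_real_mul, hform])
  have hd : q * subst H (1 + linearForm b) = 1 := by
    rw [hb, subst_sub hH.hasSubst, subst_mul hH.hasSubst, subst_C, ← hδ]
    have h1 : subst H (linearForm (c (Sum.inr ()))) = f (Sum.inr ()) := by rw [hf]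
    rw [h1]
    linear_combination hr - C (r : ℂ) * hgw
  have hcomp : ∀ i, comp (fun i => linearForm (c i) * (1 + linearForm b)⁻¹) H i = q * f i := by
    intro i
    have h1 := comp_linearFractional_mul c b hH i
    have h2 : f i = subst H (linearForm (c i)) := by rw [hf]
    rw [h2, ← h1]
    linear_combination
      -(comp (fun i => linearForm (c i) * (1 + linearForm b)⁻¹) H i) * hd
  refine ⟨e, _, _, he, hT, hφ2, eq_graphMap ?_ (fun j => ?_) (fun j => hcomp _), hherm⟩
  · rw [hcomp, hgw]
  · rw [hcomp, hfz]

end Main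

end FormalCR

/-! ### Proof of the theorem -/

open FormalCR

theorem theorem5p3 (n k₁ k₂ ℓ ℓ₁ ℓ₂ : ℕ) (M : FormalHypersurface n)
    (hM : IsLeviNondegenerate M ℓ)
    (hℓ₁ : ℓ ≤ ℓ₁) (hℓ₁' : ℓ₁ + ℓ < n) (hℓ₂ : ℓ ≤ ℓ₂) (hℓ₂' : ℓ₂ + ℓ < n)
    (hk : k₁ + k₂ < n)
    (H₁ : FormalMap n (n + k₁)) (H₂ : FormalMap n (n + k₂))
    (hH₁ : IsCRTransversalEmbedding H₁ M (hyperquadric (n + k₁) ℓ₁))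
    (hH₂ : IsCRTransversalEmbedding H₂ M (hyperquadric (n + k₂) ℓ₂)) :
    ∃ (e₁ : Fin n ⊕ Fin k₁ ≃ Fin (n + k₁)) (e₂ : Fin n ⊕ Fin k₂ ≃ Fin (n + k₂))
      (T₁ : FormalMap (n + k₁) (n + k₁)) (T₂ : FormalMap (n + k₂) (n + k₂))
      (Ψ : FormalMap n n) (φ₁ : Fin k₁ → HolSeries n) (φ₂ : Fin k₂ → HolSeries n),
      IsRenumbering ℓ ℓ₁ e₁ ∧ IsRenumbering ℓ ℓ₂ e₂ ∧
      IsLocalAut T₁ (hyperquadric (n + k₁) ℓ₁) ∧ IsLocalAut T₂ (hyperquadric (n + k₂) ℓ₂) ∧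
      IsFormalBiholomorphism Ψ ∧
      (∀ j, 2 ≤ (φ₁ j).order) ∧ (∀ j, 2 ≤ (φ₂ j).order) ∧
      comp (comp T₁ H₁) Ψ = graphMap e₁ φ₁ ∧
      comp (comp T₂ H₂) Ψ = graphMap e₂ φ₂ ∧
      hermSq (ℓ₁ - ℓ) φ₁ = hermSq (ℓ₂ - ℓ) φ₂ := by
  obtain ⟨-, Φ, A, hΦ, -, hA, hassoc⟩ := hM
  have hΦ0 := hΦ.fixesZero
  have hdvd : ∀ {k ℓ' : ℕ} {H : FormalMap n (n + k)},
      IsCRTransversalEmbedding H M (hyperquadric (n + k) ℓ') →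
      quadricSeries n ℓ - A ∣ pullback (comp H Φ) (quadricSeries (n + k) ℓ') := by
    intro k ℓ' H hH
    rw [← pullback_pullback hH.fixesZero hΦ0]
    exact hassoc.symm.dvd.trans (pullback_dvd hΦ0 hH.sendsInto)
  obtain ⟨e₁, T₁, Ψ, φ₁, he₁, hT₁, hΨ, hφ₁, hgraph₁, hdvd₁⟩ := exists_graph_coordinates hℓ₁ hℓ₁'
    (comp H₁ Φ) (hH₁.fixesZero.comp hΦ0) (exists_coeff_ne_zero_of_transversal hH₁ hΦ) A hA
    (hdvd hH₁)
  have hΨ0 := hΨ.fixesZero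
  have hΦΨ : IsFormalBiholomorphism (comp Φ Ψ) :=
    ⟨hΦ0.comp hΨ0, by rw [jac_comp hΨ0]; exact hΦ.jac_isUnit.mul hΨ.jac_isUnit⟩
  -- The second embedding is taken in the coordinates `comp Φ Ψ` found for the first. The graph
  -- equation of `φ₁` divides the equation of `M` there, hence also the pullback of the second
  -- quadric.
  obtain ⟨e₂, T₂, φ₂, he₂, hT₂, hφ₂, hgraph₂, hherm⟩ := exists_graph_of_graph hk hℓ₂ hℓ₂' φ₁ hφ₁
    (comp H₂ (comp Φ Ψ)) (hH₂.fixesZero.comp hΦΨ.fixesZero)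
    (exists_coeff_ne_zero_of_transversal hH₂ hΦΨ) (by
      rw [← comp_assoc hΦ0 hΨ0, ← pullback_pullback (hH₂.fixesZero.comp hΦ0) hΨ0]
      exact hdvd₁.trans (pullback_dvd hΨ0 (hdvd hH₂)))
  refine ⟨e₁, e₂, T₁, T₂, comp Φ Ψ, φ₁, φ₂, he₁, he₂, hT₁, hT₂, hΦΨ, hφ₁, hφ₂, ?_, ?_, hherm⟩
  · rw [← hgraph₁, ← comp_assoc hΦ0 hΨ0, comp_assoc hH₁.fixesZero hΦ0]
  · rw [← hgraph₂, comp_assoc hH₂.fixesZero hΦΨ.fixesZero]
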